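/- **Theorem 1.2.** For $v\in\mathbb R$, $\mu>0$, $x_0,\phi_0\in\mathbb R$ put $z=\tfrac12(-v+i\mu)\in\mathbb C^+$ and $c=i\mu e^{\mu x_0+i\phi_0}\in\mathbb C\setminus\{0\}$, and let $$\psi(x,t;z,c)=\mu\,\operatorname{sech}\big(\mu(x-x_0-vt)\big)\,e^{i\left(xv-\frac t2(v^2-\mu^2)-\phi_0-\pi\right)}$$ be the corresponding one-soliton solution of the focusing nonlinear Schrödinger equation $i\psi_t+\tfrac12\psi_{xx}+|\psi|^2\psi=0$. Given $N\in\mathbb N$ and data $v_k,x_k,\phi_k\in\mathbb R$, $\mu_k>0$ $(1\le k\le N)$ with pairwise distinct velocities $v_k$, put $z_k=\tfrac12(-v_k+i\mu_k)$ and $c_k=i\mu_k e^{\mu_kx_k+i\phi_k}$. The $N$-soliton solution $\psi_N$ of this equation with reflectionless scattering data $\{(z_k,c_k)\}_{k=1}^N$ is defined by $\psi_N(x,t)=\lim_{z\to\infty}2iz\,[M(z;x,t)]_{12}$, where, for each $(x,t)\in\mathbb R^2$, the $2\times2$ matrix function $M(z)=M(z;x,t)$ is a solution of the following Riemann–Hilbert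 problem: $M$ is analytic with $\det M=1$ in $\mathbb C\setminus\{z_k,\overline z_k\}_{k=1}^N$; $M(z)=I+O(z^{-1})$ as $z\to\infty$; and $M$ has simple poles at the points $z_k,\overline z_k$ with $$\operatorname*{Res}_{z=z_k}M=c_ke^{2i\theta(z_k)}\lim_{z\to z_k}M(z)\begin{pmatrix}0&0\\1&0\end{pmatrix},\qquad \operatorname*{Res}_{z=\overline z_k}M=-\overline c_k\,e^{-2i\theta(\overline z_k)}\lim_{z\to\overline z_k}M(z)\begin{pmatrix}0&1\\0&0\end{pmatrix},$$ where $\theta(z)=xz+tz^2$. Let $\Delta=\min_{j\ne k}|v_j-v_k|$ (with $\Delta=+\infty$ and $1/\Delta^2=0$ if $N\le1$), $\|\boldsymbol\mu\|_\infty=\sup_k|\mu_k|$, $\|\boldsymbol\mu\|_2^2=\sum_k|\mu_k|^2$, $\psi^{(k)}(x,t)=\psi(x,t;z_k,c_k)$ and $m^{(k)}(x,t)=\int_x^\infty|\psi^{(k)}(s,t)|^2\,ds$. There are absolute constants $C_*>0$ and $C>0$ such that, for all $N$ and all such data with $\Delta>C_*\|\boldsymbol\mu\|_\infty$, the $N$-soliton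 solution $\psi_N$ exists and is unique, and for all $(x,t)\in\mathbb R^2$ $$\left|\psi_N(x,t)-\sum_{k=1}^N\psi^{(k)}(x,t)-\frac1{2i}\sum_{j=1}^N\sum_{\substack{k=1\\k\ne j}}^N\left[\frac{\psi^{(k)}(x,t)\,m^{(j)}(x,t)}{z_j-\overline z_k}-\frac{m^{(k)}(x,t)\,\psi^{(j)}(x,t)}{\overline z_j-\overline z_k}\right]\right|\le C\,\frac{\|\boldsymbol\mu\|_\infty\|\boldsymbol\mu\|_2^2}{\Delta^2}.$$ -/

import Mathlib

open scoped Topology ENNReal ComplexConjugate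

noncomputable section

namespace FNLS

/-- The discrete eigenvalue `z = (-v + iμ)/2` of a soliton with velocity `v` and amplitude `μ`. -/
def eigenvalue (v μ : ℝ) : ℂ := (-(v : ℂ) + Complex.I * μ) / 2

/-- The coefficient `c = iμ exp(μ x₀ + iφ₀)`. For `μ > 0` every nonzero complex number is of
this form. -/
def normingCoeff (μ x₀ φ₀ : ℝ) : ℂ :=
  Complex.I * μ * Complex.exp ((μ : ℂ) * x₀ + Complex.I * φ₀)

/-- The one-soliton solution
`ψ(x,t;z,c) = μ sech(μ(x - x₀ - vt)) exp(i(xv - (t/2)(v² - μ²) - φ₀ - π))` of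
`i ψ_t + ψ_xx / 2 + |ψ|² ψ = 0`, with `z = eigenvalue v μ` and `c = normingCoeff μ x₀ φ₀`. -/
def oneSoliton (v μ x₀ φ₀ : ℝ) (x t : ℝ) : ℂ :=
  ((μ / Real.cosh (μ * (x - x₀ - v * t)) : ℝ) : ℂ) *
    Complex.exp (Complex.I * ((x * v - t / 2 * (v ^ 2 - μ ^ 2) - φ₀ - Real.pi : ℝ) : ℂ))

/-- `m(x,t) = ∫_x^∞ |ψ(s,t)|² ds` for the one-soliton solution `ψ`. -/
def oneSolitonTail (v μ x₀ φ₀ : ℝ) (x t : ℝ) : ℝ :=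
  ∫ s in Set.Ioi x, ‖oneSoliton v μ x₀ φ₀ s t‖ ^ 2

/-- The phase `θ(z;x,t) = xz + tz²`. -/
def theta (z : ℂ) (x t : ℝ) : ℂ := x * z + t * z ^ 2

/-- The set of poles `{z_k, conj z_k}`. -/
def poles {N : ℕ} (z : Fin N → ℂ) : Set ℂ :=
  Set.range z ∪ Set.range fun k => conj (z k)

/-- `M` solves the Riemann--Hilbert problem with reflectionless scattering data `(z_k, c_k)`
at the point `(x,t)`. The values of `M` at the poles themselves play no role. The residue at a
(simple) pole `p` is the limit of `(w - p) M(w)` as `w → p`, `w ≠ p`. -/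
structure IsRHPSolution {N : ℕ} (z c : Fin N → ℂ) (x t : ℝ)
    (M : ℂ → Matrix (Fin 2) (Fin 2) ℂ) : Prop where
  det_eq_one : ∀ w ∉ poles z, (M w).det = 1
  analytic : ∀ i j, DifferentiableOn ℂ (fun w => M w i j) (poles z)ᶜ
  at_infinity : ∀ i j, (fun w => M w i j - (1 : Matrix (Fin 2) (Fin 2) ℂ) i j)
    =O[Filter.cocompact ℂ] fun w => w⁻¹
  residue : ∀ k, ∃ L : Matrix (Fin 2) (Fin 2) ℂ,
    Filter.Tendsto (fun w => M w * !![0, 0; 1, 0]) (𝓝[≠] z k) (𝓝 L) ∧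
    Filter.Tendsto (fun w => (w - z k) • M w) (𝓝[≠] z k)
      (𝓝 ((c k * Complex.exp (2 * Complex.I * theta (z k) x t)) • L))
  residue_conj : ∀ k, ∃ L : Matrix (Fin 2) (Fin 2) ℂ,
    Filter.Tendsto (fun w => M w * !![0, 1; 0, 0]) (𝓝[≠] conj (z k)) (𝓝 L) ∧
    Filter.Tendsto (fun w => (w - conj (z k)) • M w) (𝓝[≠] conj (z k))
      (𝓝 ((-conj (c k) * Complex.exp (-2 * Complex.I * theta (conj (z k)) x t)) • L))

/-- `ψ` is the `N`-soliton solution with reflectionless scattering data `(z_k, c_k)`: for every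
`(x,t)` it is recovered as `ψ(x,t) = lim_{w → ∞} 2i w M₁₂(w;x,t)` from a solution `M` of the
Riemann--Hilbert problem. -/
def IsNSolitonSolution {N : ℕ} (z c : Fin N → ℂ) (ψ : ℝ → ℝ → ℂ) : Prop :=
  ∀ x t : ℝ, ∃ M : ℂ → Matrix (Fin 2) (Fin 2) ℂ, IsRHPSolution z c x t M ∧
    Filter.Tendsto (fun w => 2 * Complex.I * w * M w 0 1) (Filter.cocompact ℂ) (𝓝 (ψ x t))

/-- The minimal velocity gap `Δ = min_{j ≠ k} |v_j - v_k|`. It is a positive real number if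
`2 ≤ N` and the velocities are distinct; the minimum over the empty set (`N ≤ 1`) is `∞`. -/
def velocityGap {N : ℕ} (v : Fin N → ℝ) : ℝ≥0∞ :=
  ⨅ (j : Fin N) (k : Fin N) (_ : j ≠ k), ENNReal.ofReal |v j - v k|

/-- The pairwise interaction term
`(1/2i) ∑_j ∑_{k ≠ j} [ψ⁽ᵏ⁾ m⁽ʲ⁾ / (z_j - conj z_k) - m⁽ᵏ⁾ ψ⁽ʲ⁾ / (conj z_j - conj z_k)]`. -/
def pairInteraction {N : ℕ} (v μ x₀ φ : Fin N → ℝ) (x t : ℝ) : ℂ :=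
  1 / (2 * Complex.I) * ∑ j, ∑ k ∈ Finset.univ.filter (fun k => k ≠ j),
    (oneSoliton (v k) (μ k) (x₀ k) (φ k) x t * oneSolitonTail (v j) (μ j) (x₀ j) (φ j) x t /
        (eigenvalue (v j) (μ j) - conj (eigenvalue (v k) (μ k))) -
      oneSolitonTail (v k) (μ k) (x₀ k) (φ k) x t * oneSoliton (v j) (μ j) (x₀ j) (φ j) x t /
        (conj (eigenvalue (v j) (μ j)) - conj (eigenvalue (v k) (μ k))))

end FNLS

end

/-! The residue conditions let the first row of `M` have poles only at `z_k` in the entry `M₁₁` and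
only at `conj z_k` in `M₁₂`. By Liouville both entries are partial fractions, and the residue
conditions become a finite linear system for the residues `q_k` and `-p_k`, with `ψ_N = -2i ∑ p_k`
(`IsRHPSolution.exists_residueSystem`). Conversely, a solution of the system gives the first row,
and conjugation symmetry gives the second (`IsResidueSystemSolution.isRHPSolution`). Existence and
uniqueness of `ψ_N` thus reduce to unique solvability of the system.

In that system the pole `z_k` interacts with its own conjugate through a `2 × 2` block that can be
inverted exactly. The inverted blocks have entries `a_k = (i/2) ψ⁽ᵏ⁾`, `conj a_k` and `d_k = (i/2)
m⁽ᵏ⁾` (`residueSystem_iff`), of size at most `μ_k`. What couples different solitons is the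
off-diagonal part of the Cauchy matrices `1/(z_j - conj z_k)` and `1/(conj z_j - z_k)`.

The crux is that these matrices have `ℓ²` operator norm `O(1/Δ)` uniformly in `N`. Absolute row sums
would lose a logarithm of `N`. Instead the kernel is split as `-2/(v_j - v_k)` plus an error
`O(‖μ‖/(v_j - v_k)²)`. The first part is bounded by Hilbert's inequality for separated points, which
exploits antisymmetry, and the second by Schur's test.

For `Δ` large compared with `‖μ‖` the system is then a contraction. Two terms of its Neumann series
give the sum of solitons and an interaction term. The remainder in `∑ p_k` is a pairing of `ℓ²`
vectors, so Cauchy–Schwarz bounds it by `‖μ‖ ∑ μ_k² / Δ²` (`coupledSolution`). Changing one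
denominator of the interaction term to the stated one costs an error of the same order
(`norm_interaction_sub_le`). -/

noncomputable section

namespace FNLS

/-! ### Separated points and Hilbert's inequality -/

/-- The constant in `∑_{k ≠ j} (v_j - v_k)⁻² ≤ sepConst / δ²` for `δ`-separated points. -/
def sepConst : ℝ := 4 * ∑' n : ℤ, 1 / (n : ℝ) ^ 2

lemma sepConst_nonneg : 0 ≤ sepConst :=
  mul_nonneg (by norm_num) (tsum_nonneg fun n => by positivity)

/-- For `|y| ≥ 1` the floor is a nonzero integer with `|⌊y⌋| ≤ |y| + 1 ≤ 2|y|`. -/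
lemma inv_sq_le_floor {y : ℝ} (hy : 1 ≤ |y|) : (y⁻¹) ^ 2 ≤ 4 * (1 / (⌊y⌋ : ℝ) ^ 2) := by
  have h1 := Int.floor_le y
  have h2 := Int.lt_floor_add_one y
  have hne : (⌊y⌋ : ℝ) ≠ 0 := by
    intro h
    rw [h] at h1 h2
    rw [abs_of_nonneg h1] at hy
    linarith
  have key : (⌊y⌋ : ℝ) ^ 2 ≤ 4 * y ^ 2 := by
    rcases le_or_gt 0 y with h | h
    · have : (0 : ℝ) ≤ ⌊y⌋ := by exact_mod_cast Int.floor_nonneg.2 h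
      nlinarith
    · rw [abs_of_neg h] at hy
      nlinarith
  have hy0 : y ≠ 0 := by
    rintro rfl
    simp at hy
    linarith
  rw [inv_pow, mul_one_div, ← one_div, div_le_div_iff₀ (by positivity) (by positivity)]
  linarith

/-- Partial fractions in `v r`. The three indicator terms correct for coinciding indices, where the
convention `0⁻¹ = 0` makes the naive identity fail. Summed over `r`, this computes the Gram matrix
of the Hilbert matrix. -/
lemma inv_sub_mul_inv_sub {ι : Type*} [DecidableEq ι] {v : ι → ℝ} (hv : Function.Injective v) (r s t : ι) :
    (v r - v s)⁻¹ * (v r - v t)⁻¹ =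
      (v s - v t)⁻¹ * ((v r - v s)⁻¹ - (v r - v t)⁻¹) +
        (if r = s then ((v s - v t)⁻¹) ^ 2 else 0) + (if r = t then ((v s - v t)⁻¹) ^ 2 else 0) +
        (if s = t then ((v r - v s)⁻¹) ^ 2 else 0) := by
  by_cases hst : s = t
  · subst hst
    simp [sq]
  by_cases hrs : r = s
  · subst hrs
    simp only [sub_self, inv_zero, zero_mul, hst, if_true, if_false]
    generalize (v r - v t)⁻¹ = a
    ring
  by_cases hrt : r = t
  · subst hrt
    simp only [sub_self, inv_zero, mul_zero, hst, hrs, if_true, if_false]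
    rw [← neg_sub (v r) (v s), inv_neg]
    generalize (v r - v s)⁻¹ = a
    ring
  have h1 := sub_ne_zero.2 (hv.ne hst)
  have h2 := sub_ne_zero.2 (hv.ne hrs)
  have h3 := sub_ne_zero.2 (hv.ne hrt)
  simp [hst, hrs, hrt]
  field_simp
  ring

section Separated

variable {ι : Type*} [Fintype ι]

lemma sum_inv_sq_le {v : ι → ℝ} {δ : ℝ} (hδ : 0 < δ)
    (hv : ∀ j k, j ≠ k → δ ≤ |v j - v k|) (j : ι) :
    ∑ k, ((v j - v k)⁻¹) ^ 2 ≤ sepConst / δ ^ 2 := by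
  classical
  -- Separation puts the numbers `(v j - v k) / δ` in distinct unit cells, so the sum is dominated
  -- by a sum over distinct integers.
  have hinj : Function.Injective fun k => ⌊(v j - v k) / δ⌋ := by
    intro k l hkl
    by_contra hne
    have h1 := Int.abs_sub_lt_one_of_floor_eq_floor hkl
    rw [← sub_div, abs_div, abs_of_pos hδ, div_lt_one hδ] at h1
    have := hv l k (Ne.symm hne)
    rw [show v j - v k - (v j - v l) = v l - v k by ring] at h1
    linarith
  have hsum : Summable fun n : ℤ => 1 / (n : ℝ) ^ 2 := Real.summable_one_div_int_pow.2 one_lt_two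
  have hterm : ∀ k, ((v j - v k)⁻¹) ^ 2 ≤
      4 * (1 / ((⌊(v j - v k) / δ⌋ : ℤ) : ℝ) ^ 2) / δ ^ 2 := by
    intro k
    by_cases hjk : j = k
    · subst hjk
      simp
    · have h := inv_sq_le_floor (y := (v j - v k) / δ)
        (by rw [abs_div, abs_of_pos hδ, one_le_div hδ]; exact hv j k hjk)
      rw [le_div_iff₀ (by positivity)]
      calc _ = (((v j - v k) / δ)⁻¹) ^ 2 := by rw [inv_div, div_eq_mul_inv]; ring
        _ ≤ _ := h
  calc _ ≤ ∑ k, 4 * (1 / ((⌊(v j - v k) / δ⌋ : ℤ) : ℝ) ^ 2) / δ ^ 2 :=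
        Finset.sum_le_sum fun k _ => hterm k
    _ = 4 * (∑ n ∈ Finset.univ.image fun k => ⌊(v j - v k) / δ⌋, 1 / (n : ℝ) ^ 2) / δ ^ 2 := by
        rw [Finset.sum_image fun _ _ _ _ h => hinj h, ← Finset.sum_div, ← Finset.mul_sum]
    _ ≤ _ := by
        unfold sepConst
        gcongr
        exact hsum.sum_le_tsum _ fun n _ => by positivity

/-- Schur's test for a symmetric weight. -/
lemma schur_test {w : ι → ι → ℝ} {b : ι → ι → ℂ} {R : ℝ} (hsymm : ∀ j k, w j k = w k j)
    (hR : ∀ j, ∑ k, w j k ≤ R) (hb : ∀ j k, ‖b j k‖ ≤ w j k) (x : ι → ℂ) :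
    ∑ j, ‖∑ k, b j k * x k‖ ^ 2 ≤ R ^ 2 * ∑ k, ‖x k‖ ^ 2 := by
  have hw : ∀ j k, 0 ≤ w j k := fun j k => (norm_nonneg _).trans (hb j k)
  have h1 : ∀ j, ‖∑ k, b j k * x k‖ ^ 2 ≤ R * ∑ k, w j k * ‖x k‖ ^ 2 := by
    intro j
    have h : ‖∑ k, b j k * x k‖ ≤ ∑ k, w j k * ‖x k‖ :=
      (norm_sum_le _ _).trans (Finset.sum_le_sum fun k _ => by
        rw [norm_mul]; exact mul_le_mul_of_nonneg_right (hb j k) (norm_nonneg _))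
    calc _ ≤ (∑ k, w j k * ‖x k‖) ^ 2 := by gcongr
      _ ≤ (∑ k, w j k) * ∑ k, w j k * ‖x k‖ ^ 2 := by
        refine Finset.sum_sq_le_sum_mul_sum_of_sq_le_mul _ (fun k _ => hw j k)
          (fun k _ => mul_nonneg (hw j k) (sq_nonneg _)) fun k _ => le_of_eq (by ring)
      _ ≤ _ := by
        refine mul_le_mul_of_nonneg_right (hR j)
          (Finset.sum_nonneg fun k _ => mul_nonneg (hw j k) (sq_nonneg _))
  by_cases hι : IsEmpty ι
  · simp
  have hR0 : 0 ≤ R := by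
    obtain ⟨j⟩ := not_isEmpty_iff.1 hι
    exact (Finset.sum_nonneg fun k _ => hw j k).trans (hR j)
  calc _ ≤ ∑ j, R * ∑ k, w j k * ‖x k‖ ^ 2 := Finset.sum_le_sum fun j _ => h1 j
    _ = R * ∑ k, (∑ j, w k j) * ‖x k‖ ^ 2 := by
      rw [← Finset.mul_sum, Finset.sum_comm]
      simp_rw [Finset.sum_mul]
      congr 1
      refine Finset.sum_congr rfl fun k _ => Finset.sum_congr rfl fun j _ => ?_
      rw [hsymm]
    _ ≤ R * ∑ k, R * ‖x k‖ ^ 2 := by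
      gcongr with k
      exact hR k
    _ = _ := by rw [← Finset.mul_sum]; ring

/-- An eigenvector of the Hilbert matrix with purely imaginary eigenvalue. -/
lemma hilbert_eigenvalue_le {v : ι → ℝ} {δ : ℝ} (hδ : 0 < δ)
    (hv : ∀ j k, j ≠ k → δ ≤ |v j - v k|) {u : ι → ℂ} {l : ℂ} (hl : conj l = -l)
    (hu : ∀ j, ∑ k, (((v j - v k)⁻¹ : ℝ) : ℂ) * u k = l * u j) (hu0 : 0 < ∑ k, ‖u k‖ ^ 2) :
    ‖l‖ ^ 2 ≤ 3 * sepConst / δ ^ 2 := by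
  classical
  have hinj : Function.Injective v := by
    intro j k h
    by_contra hne
    have := hv j k hne
    rw [h, sub_self, abs_zero] at this
    linarith
  set A : ι → ι → ℝ := fun j k => (v j - v k)⁻¹ with hA
  have hanti : ∀ j k, A j k = -A k j := fun j k => by simp only [hA]; rw [← neg_sub, inv_neg]
  have hu' : ∀ j, ∑ k, (A j k : ℂ) * u k = l * u j := hu
  set g : ι → ℝ := fun s => ∑ r, A r s with hg
  have hgram : ∀ s t, ∑ r, A r s * A r t = A s t * (g s - g t) + 2 * A s t ^ 2 +
      if s = t then ∑ r, A r s ^ 2 else 0 := by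
    intro s t
    rw [Finset.sum_congr rfl fun r _ => inv_sub_mul_inv_sub hinj r s t]
    simp only [Finset.sum_add_distrib, ← Finset.mul_sum, Finset.sum_sub_distrib,
      Finset.sum_ite_eq', Finset.mem_univ, if_true, hg]
    split_ifs <;> simp [hA] <;> ring
  have hconj : ∀ j, ∑ k, (A j k : ℂ) * conj (u k) = -l * conj (u j) := by
    intro j
    have := congrArg conj (hu' j)
    simpa [map_sum, hl] using this
  -- Since `l` is imaginary, `conj u` is an eigenvector for `-l`, so the left side is `‖l‖² ∑ ‖u‖²`,
  -- expanded through the Gram matrix.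
  have e1 : ∑ r, (l * u r) * (-l * conj (u r)) =
      ∑ s, ∑ t, ((∑ r, A r s * A r t : ℝ) : ℂ) * (u s * conj (u t)) := by
    simp_rw [← hconj, ← hu', Finset.sum_mul_sum]
    rw [Finset.sum_comm]
    refine Finset.sum_congr rfl fun s _ => ?_
    rw [Finset.sum_comm]
    refine Finset.sum_congr rfl fun t _ => ?_
    push_cast
    rw [Finset.sum_mul]
    refine Finset.sum_congr rfl fun r _ => ?_
    ring
  -- The only part of the Gram matrix not controlled by sums of squares cancels: by the eigenvector
  -- equations the `g s` and `g t` halves both equal `-l ∑ g |u|²`.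
  have e2 : ∑ s, ∑ t, ((A s t * (g s - g t) : ℝ) : ℂ) * (u s * conj (u t)) = 0 := by
    have h1 : ∑ s, ∑ t, ((A s t * g s : ℝ) : ℂ) * (u s * conj (u t)) =
        ∑ s, g s * u s * (-l * conj (u s)) := by
      refine Finset.sum_congr rfl fun s _ => ?_
      rw [← hconj, Finset.mul_sum]
      refine Finset.sum_congr rfl fun t _ => ?_
      push_cast; ring
    have h2 : ∑ s, ∑ t, ((A s t * g t : ℝ) : ℂ) * (u s * conj (u t)) =
        ∑ t, -(g t * conj (u t) * (l * u t)) := by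
      rw [Finset.sum_comm]
      refine Finset.sum_congr rfl fun t _ => ?_
      rw [← hu', Finset.mul_sum, ← Finset.sum_neg_distrib]
      refine Finset.sum_congr rfl fun s _ => ?_
      rw [hanti s t]
      push_cast; ring
    have : ∑ s, ∑ t, ((A s t * (g s - g t) : ℝ) : ℂ) * (u s * conj (u t)) =
        ∑ s, ∑ t, ((A s t * g s : ℝ) : ℂ) * (u s * conj (u t)) -
        ∑ s, ∑ t, ((A s t * g t : ℝ) : ℂ) * (u s * conj (u t)) := by
      simp_rw [← Finset.sum_sub_distrib]
      refine Finset.sum_congr rfl fun s _ => Finset.sum_congr rfl fun t _ => ?_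
      push_cast; ring
    rw [this, h1, h2, ← Finset.sum_sub_distrib]
    refine Finset.sum_eq_zero fun s _ => by ring
  have e3 : ∑ r, (l * u r) * (-l * conj (u r)) =
      ∑ s, ∑ t, (2 * (A s t : ℂ) ^ 2) * (u s * conj (u t)) +
        ∑ s, (∑ r, (A r s : ℂ) ^ 2) * (u s * conj (u s)) := by
    rw [e1]
    simp_rw [hgram]
    have : ∀ s t, ((A s t * (g s - g t) + 2 * A s t ^ 2 +
        (if s = t then ∑ r, A r s ^ 2 else 0) : ℝ) : ℂ) * (u s * conj (u t)) =
        ((A s t * (g s - g t) : ℝ) : ℂ) * (u s * conj (u t)) +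
        (2 * (A s t : ℂ) ^ 2) * (u s * conj (u t)) +
        (if s = t then (∑ r, (A r s : ℂ) ^ 2) * (u s * conj (u t)) else 0) := by
      intro s t
      split_ifs <;> push_cast <;> ring
    simp_rw [this, Finset.sum_add_distrib, Finset.sum_ite_eq, Finset.mem_univ, if_true, e2,
      zero_add]
  have hS := fun j => sum_inv_sq_le hδ hv j
  have hS' : ∀ j, ∑ r, A r j ^ 2 ≤ sepConst / δ ^ 2 := by
    intro j
    simp_rw [hanti _ j, neg_sq]
    exact hS j
  have n1 : ‖∑ r, (l * u r) * (-l * conj (u r))‖ = ‖l‖ ^ 2 * ∑ k, ‖u k‖ ^ 2 := by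
    have : ∑ r, (l * u r) * (-l * conj (u r)) = -l ^ 2 * ((∑ k, ‖u k‖ ^ 2 : ℝ) : ℂ) := by
      push_cast
      rw [Finset.mul_sum]
      refine Finset.sum_congr rfl fun r _ => ?_
      rw [← Complex.mul_conj']
      ring
    rw [this, norm_mul, norm_neg, norm_pow, Complex.norm_real, Real.norm_of_nonneg hu0.le]
  have n2 : ‖∑ s, ∑ t, (2 * (A s t : ℂ) ^ 2) * (u s * conj (u t))‖ ≤
      2 * (sepConst / δ ^ 2) * ∑ k, ‖u k‖ ^ 2 := by
    calc _ ≤ ∑ s, ∑ t, (A s t ^ 2 * ‖u s‖ ^ 2 + A s t ^ 2 * ‖u t‖ ^ 2) := by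
          refine (norm_sum_le _ _).trans (Finset.sum_le_sum fun s _ => (norm_sum_le _ _).trans
            (Finset.sum_le_sum fun t _ => ?_))
          simp only [norm_mul, norm_pow, RCLike.norm_conj, Complex.norm_real, Complex.norm_ofNat,
            Real.norm_eq_abs, sq_abs]
          nlinarith [mul_nonneg (sq_nonneg (A s t)) (sq_nonneg (‖u s‖ - ‖u t‖))]
      _ = ∑ s, (∑ t, A s t ^ 2) * ‖u s‖ ^ 2 + ∑ t, (∑ s, A s t ^ 2) * ‖u t‖ ^ 2 := by
          simp_rw [Finset.sum_add_distrib, Finset.sum_mul]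
          congr 1
          exact Finset.sum_comm
      _ ≤ ∑ s, (sepConst / δ ^ 2) * ‖u s‖ ^ 2 + ∑ t, (sepConst / δ ^ 2) * ‖u t‖ ^ 2 := by
          gcongr with s _ t _
          · exact hS s
          · exact hS' t
      _ = _ := by rw [← Finset.mul_sum]; ring
  have n3 : ‖∑ s, (∑ r, (A r s : ℂ) ^ 2) * (u s * conj (u s))‖ ≤
      (sepConst / δ ^ 2) * ∑ k, ‖u k‖ ^ 2 := by
    rw [Finset.mul_sum]
    refine (norm_sum_le _ _).trans (Finset.sum_le_sum fun s _ => ?_)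
    have : (∑ r, (A r s : ℂ) ^ 2) = ((∑ r, A r s ^ 2 : ℝ) : ℂ) := by push_cast; rfl
    rw [this, Complex.mul_conj', norm_mul, Complex.norm_real, Real.norm_of_nonneg
      (Finset.sum_nonneg fun _ _ => sq_nonneg _), norm_pow, Complex.norm_real, norm_norm]
    exact mul_le_mul_of_nonneg_right (hS' s) (sq_nonneg _)
  have : ‖l‖ ^ 2 * ∑ k, ‖u k‖ ^ 2 ≤ (3 * sepConst / δ ^ 2) * ∑ k, ‖u k‖ ^ 2 := by
    rw [← n1, e3]
    refine (norm_add_le _ _).trans ((add_le_add n2 n3).trans (le_of_eq ?_))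
    ring
  exact le_of_mul_le_mul_right this hu0

/-- Hilbert's inequality for `δ`-separated points. -/
lemma hilbert_inequality {v : ι → ℝ} {δ : ℝ} (hδ : 0 < δ)
    (hv : ∀ j k, j ≠ k → δ ≤ |v j - v k|) (x : ι → ℂ) :
    ∑ j, ‖∑ k, (((v j - v k)⁻¹ : ℝ) : ℂ) * x k‖ ^ 2 ≤
      3 * sepConst / δ ^ 2 * ∑ k, ‖x k‖ ^ 2 := by
  classical
  -- The factor `i` turns the real antisymmetric matrix into a Hermitian one. An orthonormal
  -- eigenbasis then reduces the inequality to a bound on each eigenvalue.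
  set H : Matrix ι ι ℂ := Matrix.of fun j k => Complex.I * (((v j - v k)⁻¹ : ℝ) : ℂ) with hH
  have hherm : H.IsHermitian := by
    ext j k
    simp only [hH, Matrix.conjTranspose_apply, Matrix.of_apply, star_mul', RCLike.star_def,
      Complex.conj_I, Complex.conj_ofReal]
    rw [← neg_sub (v j), inv_neg]
    push_cast; ring
  have hmul : ∀ (y : ι → ℂ) j, (H.mulVec y) j =
      Complex.I * ∑ k, (((v j - v k)⁻¹ : ℝ) : ℂ) * y k := by
    intro y j
    simp only [hH, Matrix.mulVec, dotProduct, Matrix.of_apply, Finset.mul_sum, mul_assoc]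
  have heig : ∀ i, hherm.eigenvalues i ^ 2 ≤ 3 * sepConst / δ ^ 2 := by
    intro i
    have h := hherm.mulVec_eigenvectorBasis i
    have hnorm : ∑ k, ‖hherm.eigenvectorBasis i k‖ ^ 2 = 1 := by
      rw [← EuclideanSpace.norm_sq_eq, hherm.eigenvectorBasis.orthonormal.1 i, one_pow]
    have := hilbert_eigenvalue_le hδ hv (u := fun k => hherm.eigenvectorBasis i k)
      (l := -Complex.I * hherm.eigenvalues i) (by simp) (by
        intro j
        have hj := congrFun h j
        rw [hmul] at hj
        simp only [Pi.smul_apply, Complex.real_smul] at hj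
        linear_combination (-Complex.I) * hj +
          (∑ k, (((v j - v k)⁻¹ : ℝ) : ℂ) * hherm.eigenvectorBasis i k) * Complex.I_sq)
      (by rw [hnorm]; exact one_pos)
    simpa using this
  set X : EuclideanSpace ℂ ι := WithLp.toLp 2 x
  set Y : EuclideanSpace ℂ ι := WithLp.toLp 2 (H.mulVec x) with hY
  have hcoord : ∀ i, inner ℂ (hherm.eigenvectorBasis i) Y =
      hherm.eigenvalues i * inner ℂ (hherm.eigenvectorBasis i) X := by
    intro i
    have hs : (Matrix.toEuclideanLin H).IsSymmetric := Matrix.isSymmetric_toEuclideanLin_iff.2 hherm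
    have e : Y = Matrix.toEuclideanLin H X := rfl
    have e' : Matrix.toEuclideanLin H (hherm.eigenvectorBasis i) =
        (hherm.eigenvalues i : ℂ) • hherm.eigenvectorBasis i := by
      ext j
      have := congrFun (hherm.mulVec_eigenvectorBasis i) j
      simpa using this
    rw [e, ← hs, e', inner_smul_left]
    simp
  have hXn : ‖X‖ ^ 2 = ∑ k, ‖x k‖ ^ 2 := EuclideanSpace.norm_sq_eq _
  have hYn : ‖Y‖ ^ 2 = ∑ j, ‖∑ k, (((v j - v k)⁻¹ : ℝ) : ℂ) * x k‖ ^ 2 := by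
    rw [EuclideanSpace.norm_sq_eq]
    refine Finset.sum_congr rfl fun j _ => ?_
    simp only [hY, hmul, norm_mul, Complex.norm_I, one_mul]
  rw [← hXn, ← hYn, ← hherm.eigenvectorBasis.sum_sq_norm_inner_right Y,
    ← hherm.eigenvectorBasis.sum_sq_norm_inner_right X, Finset.mul_sum]
  refine Finset.sum_le_sum fun i _ => ?_
  rw [hcoord, norm_mul, mul_pow]
  refine mul_le_mul_of_nonneg_right ?_ (sq_nonneg _)
  simpa using heig i

/-- Hilbert's inequality for a perturbed kernel, as an operator norm bound. -/
lemma norm_toEuclideanCLM_le [DecidableEq ι] {v : ι → ℝ} {δ m : ℝ} (hδ : 0 < δ)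
    (hmδ : m ≤ δ) (hv : ∀ j k, j ≠ k → δ ≤ |v j - v k|) {b : Matrix ι ι ℂ}
    (hb : ∀ j k, ‖b j k + 2 * (((v j - v k)⁻¹ : ℝ) : ℂ)‖ ≤ 4 * m * ((v j - v k)⁻¹) ^ 2) :
    ‖Matrix.toEuclideanCLM (𝕜 := ℂ) b‖ ≤ (2 * √(3 * sepConst) + 4 * sepConst) / δ := by
  have hK := sepConst_nonneg
  refine ContinuousLinearMap.opNorm_le_bound _ (by positivity) fun x => ?_
  set y : EuclideanSpace ℂ ι := WithLp.toLp 2 fun j => ∑ k, (((v j - v k)⁻¹ : ℝ) : ℂ) * x k with hy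
  set e : EuclideanSpace ℂ ι := WithLp.toLp 2 fun j =>
    ∑ k, (b j k + 2 * (((v j - v k)⁻¹ : ℝ) : ℂ)) * x k with he
  -- `y` carries the conditionally bounded Hilbert kernel, `e` the remainder, which Schur's test
  -- handles in absolute value.
  have hdec : Matrix.toEuclideanCLM (𝕜 := ℂ) b x = e - (2 : ℂ) • y := by
    ext j
    simp only [he, hy, Matrix.ofLp_toEuclideanCLM, Matrix.mulVec, dotProduct, PiLp.sub_apply,
      PiLp.smul_apply, smul_eq_mul, Finset.mul_sum, ← Finset.sum_sub_distrib]
    refine Finset.sum_congr rfl fun k _ => by ring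
  have hyn : ‖y‖ ≤ √(3 * sepConst) / δ * ‖x‖ := by
    refine le_of_sq_le_sq ?_ (by positivity)
    rw [EuclideanSpace.norm_sq_eq, mul_pow, div_pow, Real.sq_sqrt (by positivity),
      EuclideanSpace.norm_sq_eq]
    exact hilbert_inequality hδ hv _
  have hen : ‖e‖ ≤ 4 * sepConst / δ * ‖x‖ := by
    refine le_of_sq_le_sq ?_ (by positivity)
    rw [EuclideanSpace.norm_sq_eq, mul_pow, EuclideanSpace.norm_sq_eq]
    refine schur_test (w := fun j k => 4 * m * ((v j - v k)⁻¹) ^ 2) (fun j k => ?_) (fun j => ?_)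
      hb _
    · rw [← neg_sub, inv_neg, neg_sq]
    · rw [← Finset.mul_sum]
      calc _ ≤ 4 * δ * (sepConst / δ ^ 2) := by
            gcongr
            exact sum_inv_sq_le hδ hv j
        _ = _ := by field_simp
  rw [hdec]
  calc _ ≤ ‖e‖ + ‖(2 : ℂ) • y‖ := norm_sub_le _ _
    _ = ‖e‖ + 2 * ‖y‖ := by rw [norm_smul]; simp
    _ ≤ 4 * sepConst / δ * ‖x‖ + 2 * (√(3 * sepConst) / δ * ‖x‖) := by gcongr
    _ = _ := by ring

end Separated

open Filter Asymptotics

/-! ### Removable singularities, Liouville's theorem and partial fractions -/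

section PartialFractions

/-- Riemann's removable singularity theorem, applied to one point at a time: `(w - s) f(w) → 0` is
exactly its growth condition. -/
lemma exists_differentiable_extension (S : Finset ℂ) : ∀ f : ℂ → ℂ,
    DifferentiableOn ℂ f (S : Set ℂ)ᶜ →
    (∀ s ∈ S, Tendsto (fun w => (w - s) * f w) (𝓝[≠] s) (𝓝 0)) →
    ∃ g : ℂ → ℂ, Differentiable ℂ g ∧ ∀ w ∉ S, g w = f w := by
  induction S using Finset.induction_on with
  | empty =>
    intro f hf _
    exact ⟨f, by simpa [differentiableOn_univ] using hf, fun _ _ => rfl⟩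
  | insert s S hs ih =>
    intro f hf hlim
    set f' := Function.update f s (limUnder (𝓝[≠] s) f) with hf'
    have hSo : IsOpen ((S : Set ℂ)ᶜ) := S.finite_toSet.isClosed.isOpen_compl
    have hmem : (S : Set ℂ)ᶜ ∈ 𝓝 s := hSo.mem_nhds (by simpa using hs)
    have hd : DifferentiableOn ℂ f' (S : Set ℂ)ᶜ := by
      refine Complex.differentiableOn_update_limUnder_of_isLittleO hmem ?_ ?_
      · refine hf.mono fun w hw => ?_
        simp only [Finset.coe_insert, Set.mem_compl_iff, Set.mem_insert_iff, not_or]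
        exact ⟨hw.2, hw.1⟩
      · rw [isLittleO_iff_tendsto']
        · have h1 := hlim s (Finset.mem_insert_self _ _)
          have h2 : Tendsto (fun w => (w - s) * f s) (𝓝[≠] s) (𝓝 0) := by
            have : Tendsto (fun w => (w - s) * f s) (𝓝 s) (𝓝 ((s - s) * f s)) :=
              Continuous.tendsto (by fun_prop) s
            rw [sub_self, zero_mul] at this
            exact this.mono_left nhdsWithin_le_nhds
          have := h1.sub h2
          rw [sub_zero] at this
          refine this.congr fun w => ?_
          rw [div_inv_eq_mul]; ring
        · filter_upwards [self_mem_nhdsWithin] with w hw h0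
          exact absurd (inv_eq_zero.1 h0) (sub_ne_zero.2 hw)
    obtain ⟨g, hg, hgf⟩ := ih f' hd fun r hr => by
      have hrs : r ≠ s := fun h => hs (h ▸ hr)
      refine (hlim r (Finset.mem_insert_of_mem hr)).congr' ?_
      have : ∀ᶠ w in 𝓝[≠] r, w ≠ s :=
        nhdsWithin_le_nhds (isOpen_ne.mem_nhds hrs)
      filter_upwards [this] with w hw
      rw [hf', Function.update_of_ne hw]
    refine ⟨g, hg, fun w hw => ?_⟩
    rw [Finset.mem_insert, not_or] at hw
    rw [hgf w hw.2, hf', Function.update_of_ne hw.1]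

lemma eventually_notMem_cocompact {S : Set ℂ} (hS : S.Finite) :
    ∀ᶠ w in cocompact ℂ, w ∉ S :=
  hS.isCompact.compl_mem_cocompact

lemma eventually_notMem_punctured {S : Set ℂ} (hS : S.Finite) (s : ℂ) :
    ∀ᶠ w in 𝓝[≠] s, w ∉ S := by
  have h : (S \ {s})ᶜ ∈ 𝓝 s := (hS.sdiff.isClosed.isOpen_compl).mem_nhds (by simp)
  filter_upwards [nhdsWithin_le_nhds h, self_mem_nhdsWithin] with w hw hws hwS
  exact hw ⟨hwS, hws⟩

lemma eq_zero_of_removable {S : Set ℂ} (hS : S.Finite) {f : ℂ → ℂ} (hf : DifferentiableOn ℂ f Sᶜ)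
    (hlim : ∀ s ∈ S, Tendsto (fun w => (w - s) * f w) (𝓝[≠] s) (𝓝 0))
    (hinf : Tendsto f (cocompact ℂ) (𝓝 0)) {w : ℂ} (hw : w ∉ S) : f w = 0 := by
  obtain ⟨g, hg, hgf⟩ := exists_differentiable_extension hS.toFinset f (by simpa using hf)
    (by simpa using hlim)
  simp only [Set.Finite.mem_toFinset] at hgf
  rw [← hgf w hw]
  refine hg.apply_eq_of_tendsto_cocompact w (hinf.congr' ?_)
  filter_upwards [eventually_notMem_cocompact hS] with u hu using (hgf u hu).symm

variable {ι : Type*} [Fintype ι]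

/-- The partial fraction `e + ∑ r_k / (w - ζ_k)`. -/
def partialFraction (e : ℂ) (r ζ : ι → ℂ) (w : ℂ) : ℂ := e + ∑ k, r k / (w - ζ k)

lemma differentiableAt_partialFraction (e : ℂ) (r : ι → ℂ) {ζ : ι → ℂ} {w : ℂ}
    (hw : ∀ k, ζ k ≠ w) : DifferentiableAt ℂ (partialFraction e r ζ) w := by
  unfold partialFraction
  refine (differentiableAt_const e).add (DifferentiableAt.fun_sum fun k _ => ?_)
  exact (differentiableAt_const _).div (differentiableAt_id.sub_const _)
    (sub_ne_zero.2 (hw k).symm)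

lemma tendsto_residue_partialFraction [DecidableEq ℂ] (e : ℂ) (r ζ : ι → ℂ) (s : ℂ) :
    Tendsto (fun w => (w - s) * partialFraction e r ζ w) (𝓝[≠] s)
      (𝓝 (∑ k, if ζ k = s then r k else 0)) := by
  have h0 : Tendsto (fun w => w - s) (𝓝[≠] s) (𝓝 0) := by
    have : Tendsto (fun w => w - s) (𝓝 s) (𝓝 (s - s)) := Continuous.tendsto (by fun_prop) s
    rw [sub_self] at this
    exact this.mono_left nhdsWithin_le_nhds
  have hk : ∀ k, Tendsto (fun w => (w - s) * (r k / (w - ζ k))) (𝓝[≠] s)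
      (𝓝 (if ζ k = s then r k else 0)) := by
    intro k
    split_ifs with h
    · refine tendsto_const_nhds.congr' ?_
      filter_upwards [self_mem_nhdsWithin] with w hw
      rw [h, mul_div_cancel₀]
      exact sub_ne_zero.2 hw
    · have hc : Tendsto (fun w => r k / (w - ζ k)) (𝓝[≠] s) (𝓝 (r k / (s - ζ k))) := by
        have : ContinuousAt (fun w => r k / (w - ζ k)) s :=
          continuousAt_const.div (continuousAt_id.sub continuousAt_const)
            (sub_ne_zero.2 (Ne.symm h))
        exact this.tendsto.mono_left nhdsWithin_le_nhds
      simpa using h0.mul hc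
  have := (h0.mul_const e).add (tendsto_finsetSum Finset.univ fun k _ => hk k)
  rw [zero_mul, zero_add] at this
  refine this.congr fun w => ?_
  rw [partialFraction, mul_add, Finset.mul_sum]

lemma tendsto_div_sub_cocompact (r ζ : ℂ) :
    Tendsto (fun w => w * (r / (w - ζ))) (cocompact ℂ) (𝓝 r) := by
  have hinv : Tendsto (fun w : ℂ => (w - ζ)⁻¹) (cocompact ℂ) (𝓝 0) := by
    rw [← Metric.cobounded_eq_cocompact]
    exact tendsto_inv₀_cobounded.comp (tendsto_sub_const_cobounded ζ)
  have := (hinv.const_mul (r * ζ)).add_const r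
  rw [mul_zero, zero_add] at this
  refine this.congr' ?_
  filter_upwards [eventually_notMem_cocompact (Set.finite_singleton ζ)] with w hw
  have : w - ζ ≠ 0 := sub_ne_zero.2 hw
  field_simp
  ring

lemma tendsto_partialFraction_cocompact (e : ℂ) (r ζ : ι → ℂ) :
    Tendsto (fun w => w * (partialFraction e r ζ w - e)) (cocompact ℂ) (𝓝 (∑ k, r k)) := by
  refine (tendsto_finsetSum Finset.univ
    fun k _ => tendsto_div_sub_cocompact (r k) (ζ k)).congr fun w => ?_
  rw [partialFraction, add_sub_cancel_left, Finset.mul_sum]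

lemma isBigO_partialFraction (e : ℂ) (r ζ : ι → ℂ) :
    (fun w => partialFraction e r ζ w - e) =O[cocompact ℂ] fun w => w⁻¹ := by
  have h := ((tendsto_partialFraction_cocompact e r ζ).isBigO_one ℂ).mul
    (isBigO_refl (fun w : ℂ => w⁻¹) (cocompact ℂ))
  refine (h.congr' ?_ ?_)
  · filter_upwards [eventually_notMem_cocompact (Set.finite_singleton (0 : ℂ))] with w hw
    have : w ≠ 0 := hw
    field_simp
  · filter_upwards with w using one_mul _

lemma tendsto_zero_of_isBigO_inv {f : ℂ → ℂ} (hf : f =O[cocompact ℂ] fun w => w⁻¹) :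
    Tendsto f (cocompact ℂ) (𝓝 0) := by
  refine hf.trans_tendsto ?_
  rw [← Metric.cobounded_eq_cocompact]
  exact tendsto_inv₀_cobounded

/-- A function with finitely many simple poles and a limit at infinity is determined by its
residues. -/
lemma eq_partialFraction [DecidableEq ℂ] {S : Set ℂ} (hS : S.Finite) {f : ℂ → ℂ} {e : ℂ}
    {r ζ : ι → ℂ} (hζ : Set.range ζ ⊆ S) (hf : DifferentiableOn ℂ f Sᶜ)
    (hlim : ∀ s ∈ S, Tendsto (fun w => (w - s) * f w) (𝓝[≠] s)
      (𝓝 (∑ k, if ζ k = s then r k else 0)))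
    (hinf : (fun w => f w - e) =O[cocompact ℂ] fun w => w⁻¹) {w : ℂ} (hw : w ∉ S) :
    f w = partialFraction e r ζ w := by
  have hne : ∀ u ∉ S, ∀ k, ζ k ≠ u := fun u hu k h => hu (h ▸ hζ ⟨k, rfl⟩)
  refine sub_eq_zero.1 (eq_zero_of_removable hS
    (f := fun u => f u - partialFraction e r ζ u) ?_ ?_ ?_ hw)
  · exact hf.sub fun u hu =>
      (differentiableAt_partialFraction e r (hne u hu)).differentiableWithinAt
  · intro s hs
    have := (hlim s hs).sub (tendsto_residue_partialFraction e r ζ s)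
    rw [sub_self] at this
    exact this.congr fun u => (mul_sub _ _ _).symm
  · refine tendsto_zero_of_isBigO_inv ((hinf.sub (isBigO_partialFraction e r ζ)).congr_left
      fun u => ?_)
    ring

end PartialFractions

/-! ### The Riemann–Hilbert problem as a finite linear system -/

section LinearSystem

variable {N : ℕ}

/-- The linear system for the residues `q_k` and `-p_k` of the first row of a solution of the
Riemann--Hilbert problem with residue coefficients `γ_k`. -/
def IsResidueSystemSolution (z γ p q : Fin N → ℂ) : Prop :=
  ∀ k, p k = conj (γ k) * partialFraction 1 q z (conj (z k)) ∧
    q k = γ k * partialFraction 0 (-p) (fun l => conj (z l)) (z k)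

/-- The residue coefficient `c exp(2iθ(z))`. -/
def residueCoeff (z c : ℂ) (x t : ℝ) : ℂ := c * Complex.exp (2 * Complex.I * theta z x t)

lemma conj_residueCoeff (z c : ℂ) (x t : ℝ) : conj (residueCoeff z c x t) =
    conj c * Complex.exp (-2 * Complex.I * theta (conj z) x t) := by
  simp only [residueCoeff, theta, map_mul, ← Complex.exp_conj, map_add, map_pow,
    Complex.conj_ofReal, Complex.conj_I, map_ofNat]
  ring_nf

lemma finite_poles (z : Fin N → ℂ) : (poles z).Finite :=
  (Set.finite_range _).union (Set.finite_range _)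

lemma ne_conj_of_im_pos {z w : ℂ} (hz : 0 < z.im) (hw : 0 < w.im) : z ≠ conj w := by
  intro h
  have := congrArg Complex.im h
  rw [Complex.conj_im] at this
  linarith

/-- Multiplying by the nilpotent matrix at `z_k` moves the second column into the first and kills
the other. Hence `M₁₁` has residue `γ_k M₁₂(z_k)` there while `M₁₂` is regular; the roles swap at
`conj z_k`. Evaluating each partial fraction at the poles of the other closes the system. -/
lemma IsRHPSolution.exists_residueSystem {z c : Fin N → ℂ} {x t : ℝ}
    {M : ℂ → Matrix (Fin 2) (Fin 2) ℂ} (hM : IsRHPSolution z c x t M)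
    (hz : Function.Injective z) (him : ∀ k, 0 < (z k).im) :
    ∃ p q, IsResidueSystemSolution z (fun k => residueCoeff (z k) (c k) x t) p q ∧
      Tendsto (fun w => 2 * Complex.I * w * M w 0 1) (cocompact ℂ)
        (𝓝 (-2 * Complex.I * ∑ k, p k)) := by
  classical
  have hne : ∀ j k, z j ≠ conj (z k) := fun j k => ne_conj_of_im_pos (him j) (him k)
  have hzc : ∀ j k, conj (z j) = conj (z k) ↔ j = k := fun j k =>
    ((starRingEnd ℂ).injective.eq_iff.trans hz.eq_iff)
  choose L hL hLres using hM.residue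
  choose L' hL' hLres' using hM.residue_conj
  have entry : ∀ {F : Filter ℂ} {f : ℂ → Matrix (Fin 2) (Fin 2) ℂ} {A} (i j : Fin 2),
      Tendsto f F (𝓝 A) → Tendsto (fun w => f w i j) F (𝓝 (A i j)) := fun i j h =>
    tendsto_pi_nhds.1 (tendsto_pi_nhds.1 h i) j
  have b_val : ∀ k, Tendsto (fun w => M w 0 1) (𝓝[≠] z k) (𝓝 (L k 0 0)) := fun k => by
    simpa [Matrix.mul_apply] using entry 0 0 (hL k)
  have a_val : ∀ k, Tendsto (fun w => M w 0 0) (𝓝[≠] conj (z k)) (𝓝 (L' k 0 1)) := fun k => by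
    simpa [Matrix.mul_apply] using entry 0 1 (hL' k)
  set γ : Fin N → ℂ := fun k => residueCoeff (z k) (c k) x t with hγ
  have a_res : ∀ k, Tendsto (fun w => (w - z k) * M w 0 0) (𝓝[≠] z k)
      (𝓝 (γ k * L k 0 0)) := fun k => by
    simpa [hγ, residueCoeff] using entry 0 0 (hLres k)
  have b_res : ∀ k, Tendsto (fun w => (w - conj (z k)) * M w 0 1) (𝓝[≠] conj (z k))
      (𝓝 (-(conj (γ k) * L' k 0 1))) := fun k => by
    have := entry 0 1 (hLres' k)
    simp only [Matrix.smul_apply, smul_eq_mul] at this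
    rw [hγ, conj_residueCoeff]
    convert this using 2
    ring
  have h0 : ∀ s : ℂ, Tendsto (fun w => w - s) (𝓝[≠] s) (𝓝 0) := fun s => by
    have : Tendsto (fun w => w - s) (𝓝 s) (𝓝 (s - s)) := Continuous.tendsto (by fun_prop) s
    rw [sub_self] at this
    exact this.mono_left nhdsWithin_le_nhds
  set q : Fin N → ℂ := fun k => γ k * L k 0 0 with hq
  set p : Fin N → ℂ := fun k => conj (γ k) * L' k 0 1 with hp
  have a_eq : ∀ w ∉ poles z, M w 0 0 = partialFraction 1 q z w := fun w hw => by
    refine eq_partialFraction (f := fun w => M w 0 0) (finite_poles z) Set.subset_union_left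
      (hM.analytic 0 0) ?_ (by simpa using hM.at_infinity 0 0) hw
    rintro s (⟨k, rfl⟩ | ⟨k, rfl⟩)
    · simpa [hz.eq_iff] using a_res k
    · simpa [hne] using (h0 _).mul (a_val k)
  have b_eq : ∀ w ∉ poles z, M w 0 1 = partialFraction 0 (-p) (fun l => conj (z l)) w :=
    fun w hw => by
    refine eq_partialFraction (f := fun w => M w 0 1) (finite_poles z) Set.subset_union_right
      (hM.analytic 0 1) ?_ (by simpa using hM.at_infinity 0 1) hw
    rintro s (⟨k, rfl⟩ | ⟨k, rfl⟩)
    · simpa [fun j k => (hne j k).symm] using (h0 _).mul (b_val k)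
    · simpa [hzc] using b_res k
  refine ⟨p, q, fun k => ⟨?_, ?_⟩, ?_⟩
  · have h1 := (differentiableAt_partialFraction 1 q (ζ := z)
      (fun l => hne l k)).continuousAt.tendsto.mono_left (nhdsWithin_le_nhds (s := {conj (z k)}ᶜ))
    have h2 := (a_val k).congr' ((eventually_notMem_punctured (finite_poles z) _).mono a_eq)
    simp only [hp]
    rw [tendsto_nhds_unique h2 h1]
  · have h1 := (differentiableAt_partialFraction 0 (-p) (ζ := fun l => conj (z l))
      (fun l => (hne k l).symm)).continuousAt.tendsto.mono_left
      (nhdsWithin_le_nhds (s := {z k}ᶜ))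
    have h2 := (b_val k).congr' ((eventually_notMem_punctured (finite_poles z) _).mono b_eq)
    simp only [hq]
    rw [tendsto_nhds_unique h2 h1]
  · have := (tendsto_partialFraction_cocompact 0 (-p) fun l => conj (z l)).const_mul
      (2 * Complex.I)
    rw [show 2 * Complex.I * ∑ k, (-p) k = -2 * Complex.I * ∑ k, p k by
      simp [Finset.sum_neg_distrib]] at this
    refine this.congr' ?_
    filter_upwards [eventually_notMem_cocompact (finite_poles z)] with w hw
    rw [b_eq w hw, sub_zero]
    ring

/-- The solution of the Riemann--Hilbert problem built from a solution of the residue system. -/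
def rhpMatrix (z p q : Fin N → ℂ) (w : ℂ) : Matrix (Fin 2) (Fin 2) ℂ :=
  !![partialFraction 1 q z w, partialFraction 0 (-p) (fun l => conj (z l)) w;
    partialFraction 0 (fun k => conj (p k)) z w,
    partialFraction 1 (fun k => conj (q k)) (fun l => conj (z l)) w]

lemma conj_partialFraction (e : ℂ) (r ζ : Fin N → ℂ) (w : ℂ) :
    conj (partialFraction e r ζ w) =
      partialFraction (conj e) (fun k => conj (r k)) (fun k => conj (ζ k)) (conj w) := by
  simp [partialFraction, map_sum]

/-- `det - 1` is a rational function vanishing at infinity. Splitting products of simple poles at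
distinct points exhibits it as a sum of simple poles, and the system with its complex conjugate
makes each residue zero. -/
lemma det_rhpMatrix {z γ p q : Fin N → ℂ} (h : IsResidueSystemSolution z γ p q)
    (him : ∀ k, 0 < (z k).im) {w : ℂ} (hw : w ∉ poles z) : (rhpMatrix z p q w).det = 1 := by
  have hne : ∀ j k, z j - conj (z k) ≠ 0 := fun j k =>
    sub_ne_zero.2 (ne_conj_of_im_pos (him j) (him k))
  have hw1 : ∀ k, w - z k ≠ 0 := fun k => sub_ne_zero.2 fun e => hw (Or.inl ⟨k, e.symm⟩)
  have hw2 : ∀ k, w - conj (z k) ≠ 0 := fun k => sub_ne_zero.2 fun e => hw (Or.inr ⟨k, e.symm⟩)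
  have hsplit : ∀ f g : Fin N → ℂ, (∑ j, f j / (w - z j)) * (∑ k, g k / (w - conj (z k))) =
      ∑ j, f j * (∑ k, g k / (z j - conj (z k))) / (w - z j) +
      ∑ k, g k * (∑ j, f j / (conj (z k) - z j)) / (w - conj (z k)) := by
    intro f g
    simp_rw [Finset.sum_mul_sum, Finset.mul_sum, Finset.sum_div]
    rw [Finset.sum_comm (f := fun k j => g k * (f j / (conj (z k) - z j)) / (w - conj (z k)))]
    simp_rw [← Finset.sum_add_distrib]
    refine Finset.sum_congr rfl fun j _ => Finset.sum_congr rfl fun k _ => ?_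
    have h1 := hne j k
    have h2 := hw1 j
    have h3 := hw2 k
    rw [← neg_sub (z j) (conj (z k)), div_neg]
    field_simp
    ring
  have hp : ∀ k, p k = conj (γ k) * (1 + ∑ l, q l / (conj (z k) - z l)) := fun k => (h k).1
  have hq : ∀ k, q k = γ k * ∑ l, -p l / (z k - conj (z l)) := fun k => by
    have := (h k).2
    simpa only [partialFraction, zero_add, Pi.neg_apply] using this
  have hp' : ∀ k, conj (p k) = γ k * (1 + ∑ l, conj (q l) / (z k - conj (z l))) := fun k => by
    have := congrArg conj (hp k)
    simpa [map_sum] using this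
  have hq' : ∀ k, conj (q k) = conj (γ k) * ∑ l, -conj (p l) / (conj (z k) - z l) := fun k => by
    have := congrArg conj (hq k)
    simpa [map_sum] using this
  rw [rhpMatrix, Matrix.det_fin_two_of]
  simp only [partialFraction, zero_add, Pi.neg_apply]
  have e1 : (1 + ∑ k, q k / (w - z k)) * (1 + ∑ k, conj (q k) / (w - conj (z k))) -
      (∑ k, -p k / (w - conj (z k))) * (∑ k, conj (p k) / (w - z k)) - 1 =
      ∑ k, q k / (w - z k) + ∑ k, conj (q k) / (w - conj (z k)) +
      (∑ k, q k / (w - z k)) * (∑ k, conj (q k) / (w - conj (z k))) -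
      (∑ k, conj (p k) / (w - z k)) * (∑ k, -p k / (w - conj (z k))) := by ring
  rw [← sub_eq_zero, e1, hsplit, hsplit]
  have e2 : ∑ k, q k / (w - z k) +
      ∑ j, q j * (∑ k, conj (q k) / (z j - conj (z k))) / (w - z j) =
      ∑ j, conj (p j) * (∑ k, -p k / (z j - conj (z k))) / (w - z j) := by
    rw [← Finset.sum_add_distrib]
    refine Finset.sum_congr rfl fun j _ => ?_
    rw [← add_div]
    congr 1
    rw [hp' j]
    linear_combination (1 + ∑ l, conj (q l) / (z j - conj (z l))) * hq j
  have e3 : ∑ k, conj (q k) / (w - conj (z k)) +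
      ∑ k, conj (q k) * (∑ j, q j / (conj (z k) - z j)) / (w - conj (z k)) =
      ∑ k, -p k * (∑ j, conj (p j) / (conj (z k) - z j)) / (w - conj (z k)) := by
    rw [← Finset.sum_add_distrib]
    refine Finset.sum_congr rfl fun k _ => ?_
    rw [← add_div]
    congr 1
    have h1 := hq' k
    simp_rw [neg_div, Finset.sum_neg_distrib] at h1
    rw [hp k]
    linear_combination (1 + ∑ l, q l / (conj (z k) - z l)) * h1
  linear_combination e2 + e3

/-- The second row is chosen so that `M₂₂(w) = conj M₁₁(conj w)` and `M₂₁(w) = -conj M₁₂(conj w)`;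
its residue relations are therefore conjugates of those of the first row. -/
lemma IsResidueSystemSolution.isRHPSolution {z c p q : Fin N → ℂ} {x t : ℝ}
    (h : IsResidueSystemSolution z (fun k => residueCoeff (z k) (c k) x t) p q)
    (hz : Function.Injective z) (him : ∀ k, 0 < (z k).im) :
    IsRHPSolution z c x t (rhpMatrix z p q) := by
  classical
  have hne : ∀ j k, z j ≠ conj (z k) := fun j k => ne_conj_of_im_pos (him j) (him k)
  have hzc : ∀ j k, conj (z j) = conj (z k) ↔ j = k := fun j k =>
    ((starRingEnd ℂ).injective.eq_iff.trans hz.eq_iff)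
  have ofEntries : ∀ {F : Filter ℂ} {f : ℂ → Matrix (Fin 2) (Fin 2) ℂ} {A},
      (∀ i j, Tendsto (fun w => f w i j) F (𝓝 (A i j))) → Tendsto f F (𝓝 A) := fun h =>
    tendsto_pi_nhds.2 fun i => tendsto_pi_nhds.2 fun j => h i j
  have val : ∀ (e : ℂ) (r : Fin N → ℂ) {ζ : Fin N → ℂ} {s : ℂ}, (∀ k, ζ k ≠ s) →
      Tendsto (partialFraction e r ζ) (𝓝[≠] s) (𝓝 (partialFraction e r ζ s)) :=
    fun e r ζ s hs =>
      (differentiableAt_partialFraction e r hs).continuousAt.tendsto.mono_left nhdsWithin_le_nhds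
  have res := fun (e : ℂ) (r ζ : Fin N → ℂ) (s : ℂ) => tendsto_residue_partialFraction e r ζ s
  refine ⟨fun w hw => det_rhpMatrix h him hw, fun i j w hw => ?_, fun i j => ?_, fun k => ?_,
    fun k => ?_⟩
  · have hw1 : ∀ k, z k ≠ w := fun k e => hw (Or.inl ⟨k, e⟩)
    have hw2 : ∀ k, conj (z k) ≠ w := fun k e => hw (Or.inr ⟨k, e⟩)
    refine DifferentiableAt.differentiableWithinAt ?_
    fin_cases i <;> fin_cases j
    · exact differentiableAt_partialFraction _ _ hw1
    · exact differentiableAt_partialFraction _ _ hw2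
    · exact differentiableAt_partialFraction _ _ hw1
    · exact differentiableAt_partialFraction _ _ hw2
  · fin_cases i <;> fin_cases j
    · exact isBigO_partialFraction 1 _ _
    · exact isBigO_partialFraction 0 _ _
    · exact isBigO_partialFraction 0 _ _
    · exact isBigO_partialFraction 1 _ _
  · refine ⟨!![partialFraction 0 (-p) (fun l => conj (z l)) (z k), 0;
      partialFraction 1 (fun k => conj (q k)) (fun l => conj (z l)) (z k), 0],
      ofEntries fun i j => ?_, ofEntries fun i j => ?_⟩
    · fin_cases i <;> fin_cases j
      · simpa [rhpMatrix, Matrix.mul_apply] using val 0 (-p) fun l => (hne k l).symm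
      · simp [rhpMatrix, Matrix.mul_apply]
      · simpa [rhpMatrix, Matrix.mul_apply] using
          val 1 (fun k => conj (q k)) fun l => (hne k l).symm
      · simp [rhpMatrix, Matrix.mul_apply]
    · have h1 : residueCoeff (z k) (c k) x t *
          partialFraction 0 (-p) (fun l => conj (z l)) (z k) = q k := (h k).2.symm
      have h2 : residueCoeff (z k) (c k) x t *
          partialFraction 1 (fun k => conj (q k)) (fun l => conj (z l)) (z k) = conj (p k) := by
        rw [(h k).1, map_mul, Complex.conj_conj, conj_partialFraction, Complex.conj_conj, map_one]
      change Tendsto _ _ (𝓝 ((residueCoeff (z k) (c k) x t • _ : Matrix (Fin 2) (Fin 2) ℂ) i j))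
      fin_cases i <;> fin_cases j
      · simpa [rhpMatrix, h1, hz.eq_iff] using res 1 q z (z k)
      · simpa [rhpMatrix, fun j k => (hne j k).symm] using
          res 0 (-p) (fun l => conj (z l)) (z k)
      · simpa [rhpMatrix, h2, hz.eq_iff] using res 0 (fun k => conj (p k)) z (z k)
      · simpa [rhpMatrix, fun j k => (hne j k).symm] using
          res 1 (fun k => conj (q k)) (fun l => conj (z l)) (z k)
  · refine ⟨!![0, partialFraction 1 q z (conj (z k));
      0, partialFraction 0 (fun k => conj (p k)) z (conj (z k))],
      ofEntries fun i j => ?_, ofEntries fun i j => ?_⟩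
    · fin_cases i <;> fin_cases j
      · simp [rhpMatrix, Matrix.mul_apply]
      · simpa [rhpMatrix, Matrix.mul_apply] using val 1 q fun l => hne l k
      · simp [rhpMatrix, Matrix.mul_apply]
      · simpa [rhpMatrix, Matrix.mul_apply] using val 0 (fun k => conj (p k)) fun l => hne l k
    · rw [neg_mul, ← conj_residueCoeff]
      have h1 : conj (residueCoeff (z k) (c k) x t) * partialFraction 1 q z (conj (z k)) = p k :=
        (h k).1.symm
      have h2 : conj (residueCoeff (z k) (c k) x t) *
          partialFraction 0 (fun k => conj (p k)) z (conj (z k)) = -conj (q k) := by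
        rw [(h k).2, map_mul, conj_partialFraction]
        simp [partialFraction, neg_div]
      fin_cases i <;> fin_cases j
      · simpa [rhpMatrix, hne] using res 1 q z (conj (z k))
      · simpa [rhpMatrix, h1, hzc] using res 0 (-p) (fun l => conj (z l)) (conj (z k))
      · simpa [rhpMatrix, hne] using res 0 (fun k => conj (p k)) z (conj (z k))
      · simpa [rhpMatrix, h2, hzc] using
          res 1 (fun k => conj (q k)) (fun l => conj (z l)) (conj (z k))

lemma tendsto_rhpMatrix (z p q : Fin N → ℂ) :
    Tendsto (fun w => 2 * Complex.I * w * rhpMatrix z p q w 0 1) (cocompact ℂ)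
      (𝓝 (-2 * Complex.I * ∑ k, p k)) := by
  have := (tendsto_partialFraction_cocompact 0 (-p) fun l => conj (z l)).const_mul
    (2 * Complex.I)
  rw [show 2 * Complex.I * ∑ k, (-p) k = -2 * Complex.I * ∑ k, p k by
    simp [Finset.sum_neg_distrib]] at this
  refine this.congr fun w => ?_
  simp only [rhpMatrix, sub_zero, Matrix.of_apply, Matrix.cons_val', Matrix.cons_val_zero,
    Matrix.cons_val_one]
  ring

end LinearSystem

/-! ### Neumann expansion of the coupled system -/

section Perturbation

variable {V : Type*} [NormedAddCommGroup V] [NormedSpace ℂ V]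

lemma existsUnique_fixedPoint [CompleteSpace V] {T : V →L[ℂ] V} (hT : ‖T‖ ≤ 1 / 2) (X₀ : V) :
    ∃! X, X = X₀ + T X := by
  have hT1 : ‖T‖ < 1 := by linarith
  refine ⟨(Units.oneSub T hT1)⁻¹.val X₀, ?_, ?_⟩
  · have h : ((Units.oneSub T hT1).val * (Units.oneSub T hT1)⁻¹.val) X₀ = X₀ := by
      rw [Units.mul_inv, one_apply_eq_self]
    rw [Units.val_oneSub] at h
    simp only [mul_apply_eq_comp, sub_apply,
      one_apply_eq_self] at h
    exact sub_eq_iff_eq_add.1 h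
  · intro Y hY
    have h : ((Units.oneSub T hT1)⁻¹.val * (Units.oneSub T hT1).val) Y = Y := by
      rw [Units.inv_mul, one_apply_eq_self]
    rw [mul_apply_eq_comp, Units.val_oneSub] at h
    rw [← h]
    congr 1
    simp only [sub_apply, one_apply_eq_self]
    exact sub_eq_iff_eq_add.2 hY

lemma norm_fixedPoint_le {T : V →L[ℂ] V} (hT : ‖T‖ ≤ 1 / 2) {X₀ X : V} (hX : X = X₀ + T X) :
    ‖X‖ ≤ 2 * ‖X₀‖ := by
  have h1 : ‖X‖ ≤ ‖X₀‖ + ‖T X‖ := by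
    conv_lhs => rw [hX]
    exact norm_add_le _ _
  have h2 : ‖T X‖ ≤ 1 / 2 * ‖X‖ := T.le_of_opNorm_le hT X
  linarith

variable {ι : Type*} [Fintype ι] [DecidableEq ι]

lemma norm_diagonal_le {a : ι → ℂ} {m : ℝ} (hm : 0 ≤ m) (ha : ∀ j, ‖a j‖ ≤ m) :
    ‖Matrix.toEuclideanCLM (𝕜 := ℂ) (Matrix.diagonal a)‖ ≤ m := by
  refine ContinuousLinearMap.opNorm_le_bound _ hm fun x => ?_
  refine le_of_sq_le_sq ?_ (by positivity)
  rw [EuclideanSpace.norm_sq_eq, mul_pow, EuclideanSpace.norm_sq_eq, Finset.mul_sum]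
  refine Finset.sum_le_sum fun j _ => ?_
  rw [Matrix.ofLp_toEuclideanCLM, Matrix.mulVec_diagonal, norm_mul, mul_pow]
  gcongr
  exact ha j

lemma norm_sum_mul_le {ι : Type*} [Fintype ι] (a b : ι → ℂ) :
    ‖∑ j, a j * b j‖ ≤ √(∑ j, ‖a j‖ ^ 2) * √(∑ j, ‖b j‖ ^ 2) := by
  refine (norm_sum_le _ _).trans ?_
  simp_rw [norm_mul]
  exact Real.sum_mul_le_sqrt_mul_sqrt _ _ _

/-- The coupled linear system `p = a(1 + b'q) - d(bp)`, `q = d(1 + b'q) - a'(bp)`. -/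
def IsCoupledSolution (a a' d : ι → ℂ) (b b' : Matrix ι ι ℂ) (p q : ι → ℂ) : Prop :=
  ∀ j, p j = a j * (1 + ∑ k, b' j k * q k) + d j * (-∑ k, b j k * p k) ∧
    q j = d j * (1 + ∑ k, b' j k * q k) + a' j * (-∑ k, b j k * p k)

/-- In vector form the system is `X = X₀ + DD (H X)` on `ℓ² × ℓ²` with the maximum norm, where `DD`
is the diagonal block (norm at most `2m`) and `H` the coupling (norm at most `κ`). Hence `2mκ ≤ 1/2`
gives a contraction. -/
lemma coupledSolution {a a' d : ι → ℂ} {b b' : Matrix ι ι ℂ} {μ : ι → ℝ} {m κ : ℝ}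
    (hm : ∀ j, μ j ≤ m) (hm0 : 0 ≤ m) (ha : ∀ j, ‖a j‖ ≤ μ j) (ha' : ∀ j, ‖a' j‖ ≤ μ j)
    (hd : ∀ j, ‖d j‖ ≤ μ j)
    (hb : ‖Matrix.toEuclideanCLM (𝕜 := ℂ) b‖ ≤ κ) (hb' : ‖Matrix.toEuclideanCLM (𝕜 := ℂ) b'‖ ≤ κ)
    (hκ : m * κ ≤ 1 / 4) :
    (∃! pq : (ι → ℂ) × (ι → ℂ), IsCoupledSolution a a' d b b' pq.1 pq.2) ∧
    ∀ p q, IsCoupledSolution a a' d b b' p q →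
      ‖∑ j, p j - (∑ j, a j +
        ∑ j, (a j * ∑ k, b' j k * d k - d j * ∑ k, b j k * a k))‖ ≤
        8 * m * κ ^ 2 * ∑ j, μ j ^ 2 := by
  have hκ0 : 0 ≤ κ := (norm_nonneg _).trans hb
  let cl : Matrix ι ι ℂ → EuclideanSpace ℂ ι →L[ℂ] EuclideanSpace ℂ ι := fun A => Matrix.toEuclideanCLM (𝕜 := ℂ) A
  let A := cl (Matrix.diagonal a)
  let A' := cl (Matrix.diagonal a')
  let D := cl (Matrix.diagonal d)
  let fs : EuclideanSpace ℂ ι × EuclideanSpace ℂ ι →L[ℂ] EuclideanSpace ℂ ι :=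
      ContinuousLinearMap.fst ℂ _ _
  let sn : EuclideanSpace ℂ ι × EuclideanSpace ℂ ι →L[ℂ] EuclideanSpace ℂ ι :=
      ContinuousLinearMap.snd ℂ _ _
  let DD : EuclideanSpace ℂ ι × EuclideanSpace ℂ ι →L[ℂ]
      EuclideanSpace ℂ ι × EuclideanSpace ℂ ι := (A.comp fs + D.comp sn).prod (D.comp fs + A'.comp sn)
  let H : EuclideanSpace ℂ ι × EuclideanSpace ℂ ι →L[ℂ]
      EuclideanSpace ℂ ι × EuclideanSpace ℂ ι := ((cl b').comp sn).prod (-((cl b).comp fs))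
  have hA : ‖A‖ ≤ m := norm_diagonal_le hm0 fun j => (ha j).trans (hm j)
  have hA' : ‖A'‖ ≤ m := norm_diagonal_le hm0 fun j => (ha' j).trans (hm j)
  have hD : ‖D‖ ≤ m := norm_diagonal_le hm0 fun j => (hd j).trans (hm j)
  have hDD : ∀ Y, ‖DD Y‖ ≤ 2 * m * ‖Y‖ := by
    intro Y
    have h1 := norm_fst_le Y
    have h2 := norm_snd_le Y
    have key : ∀ F G : EuclideanSpace ℂ ι →L[ℂ] EuclideanSpace ℂ ι, ‖F‖ ≤ m → ‖G‖ ≤ m → ‖F Y.1 + G Y.2‖ ≤ 2 * m * ‖Y‖ := by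
      intro F G hF hG
      calc _ ≤ ‖F Y.1‖ + ‖G Y.2‖ := norm_add_le _ _
        _ ≤ m * ‖Y.1‖ + m * ‖Y.2‖ := add_le_add (F.le_of_opNorm_le hF _) (G.le_of_opNorm_le hG _)
        _ ≤ m * ‖Y‖ + m * ‖Y‖ := by gcongr
        _ = _ := by ring
    exact max_le (key A D hA hD) (key D A' hD hA')
  have hH : ∀ Y, ‖H Y‖ ≤ κ * ‖Y‖ := by
    intro Y
    refine max_le ?_ ?_
    · exact ((cl b').le_of_opNorm_le hb' _).trans
        (mul_le_mul_of_nonneg_left (norm_snd_le Y) hκ0)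
    · change ‖-(cl b Y.1)‖ ≤ _
      rw [norm_neg]
      exact ((cl b).le_of_opNorm_le hb _).trans (mul_le_mul_of_nonneg_left (norm_fst_le Y) hκ0)
  have hT : ‖DD.comp H‖ ≤ 1 / 2 := by
    refine ContinuousLinearMap.opNorm_le_bound _ (by norm_num) fun Y => ?_
    calc ‖DD (H Y)‖ ≤ 2 * m * (κ * ‖Y‖) := (hDD _).trans (by gcongr; exact hH Y)
      _ = 2 * (m * κ) * ‖Y‖ := by ring
      _ ≤ 2 * (1 / 4) * ‖Y‖ := by gcongr
      _ = _ := by ring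
  let X₀ : EuclideanSpace ℂ ι × EuclideanSpace ℂ ι := (WithLp.toLp 2 a, WithLp.toLp 2 d)
  have hiff : ∀ p q : ι → ℂ, IsCoupledSolution a a' d b b' p q ↔
      ((WithLp.toLp 2 p, WithLp.toLp 2 q) : EuclideanSpace ℂ ι × EuclideanSpace ℂ ι) =
        X₀ + (DD.comp H) (WithLp.toLp 2 p, WithLp.toLp 2 q) := by
    intro p q
    rw [Prod.ext_iff, PiLp.ext_iff, PiLp.ext_iff, ← forall_and]
    refine forall_congr' fun j => ?_
    simp only [X₀, DD, H, A, A', D, cl, fs, sn, ContinuousLinearMap.comp_apply,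
      ContinuousLinearMap.prod_apply, add_apply,
      neg_apply, ContinuousLinearMap.coe_fst', ContinuousLinearMap.coe_snd',
      Prod.fst_add, Prod.snd_add, PiLp.add_apply, PiLp.neg_apply, Matrix.ofLp_toEuclideanCLM,
      Matrix.mulVec_diagonal]
    simp only [Matrix.mulVec, dotProduct]
    refine and_congr ?_ ?_ <;> rw [mul_add, mul_one, add_assoc]
  have hsqrt : ∀ {f : ι → ℂ}, (∀ j, ‖f j‖ ≤ μ j) →
      √(∑ j, ‖f j‖ ^ 2) ≤ √(∑ j, μ j ^ 2) := fun hf =>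
    Real.sqrt_le_sqrt (Finset.sum_le_sum fun j _ => by gcongr; exact hf j)
  have hX₀ : ‖X₀‖ ≤ √(∑ j, μ j ^ 2) := by
    refine max_le ?_ ?_
    · rw [EuclideanSpace.norm_eq]
      exact hsqrt ha
    · rw [EuclideanSpace.norm_eq]
      exact hsqrt hd
  refine ⟨?_, fun p q hpq => ?_⟩
  · obtain ⟨X, hX, huniq⟩ := existsUnique_fixedPoint hT X₀
    refine ⟨(X.1.ofLp, X.2.ofLp), (hiff _ _).2 hX, fun pq hpq => ?_⟩
    have := huniq _ ((hiff _ _).1 hpq)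
    rw [← this]
  · have hX := (hiff p q).1 hpq
    set X : EuclideanSpace ℂ ι × EuclideanSpace ℂ ι := (WithLp.toLp 2 p, WithLp.toLp 2 q) with hXdef
    have hXn : ‖X‖ ≤ 2 * √(∑ j, μ j ^ 2) :=
      (norm_fixedPoint_le hT hX).trans (by gcongr)
    -- The outermost `DD` is kept out of `Y`: its coefficients `a`, `d` are paired with `Y` by
    -- Cauchy–Schwarz, which supplies the second factor `√(∑ μ²)` and avoids any dependence on the
    -- number of indices.
    let Y := H (DD (H X))
    have hY : ‖Y‖ ≤ κ * (2 * m * (κ * (2 * √(∑ j, μ j ^ 2)))) := by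
      refine (hH _).trans ?_
      gcongr
      refine (hDD _).trans ?_
      gcongr
      refine (hH _).trans ?_
      gcongr
    have hrem : X = X₀ + DD (H X₀) + DD Y := by
      have h1 : X = X₀ + DD (H X) := hX
      have h2 : DD (H X) = DD (H X₀) + DD Y := by
        conv_lhs => rw [h1]
        rw [map_add, map_add]
      rw [add_assoc, ← h2]
      exact h1
    have hsum : ∑ j, p j - (∑ j, a j +
        ∑ j, (a j * ∑ k, b' j k * d k - d j * ∑ k, b j k * a k)) =
        ∑ j, a j * Y.1 j + ∑ j, d j * Y.2 j := by
      rw [← Finset.sum_add_distrib, ← Finset.sum_add_distrib, ← Finset.sum_sub_distrib]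
      refine Finset.sum_congr rfl fun j _ => ?_
      have h1 : X.1 j = X₀.1 j + (DD (H X₀)).1 j + (DD Y).1 j := by
        conv_lhs => rw [hrem]
        rfl
      have h2 : (DD Y).1 j = a j * Y.1 j + d j * Y.2 j := by
        change (A Y.1) j + (D Y.2) j = _
        simp only [A, D, cl, Matrix.ofLp_toEuclideanCLM, Matrix.mulVec_diagonal]
      have h3 : (DD (H X₀)).1 j = a j * ∑ k, b' j k * d k + d j * -∑ k, b j k * a k := by
        change (A (cl b' X₀.2)) j + (D (-(cl b X₀.1))) j = _
        simp only [A, D, cl, X₀, PiLp.neg_apply, Matrix.ofLp_toEuclideanCLM,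
          Matrix.mulVec_diagonal]
        simp only [Matrix.mulVec, dotProduct]
      rw [h2, h3] at h1
      change p j = a j + _ + _ at h1
      rw [h1]
      ring
    have hμ0 : (0 : ℝ) ≤ ∑ j, μ j ^ 2 := Finset.sum_nonneg fun _ _ => sq_nonneg _
    rw [hsum]
    calc _ ≤ ‖∑ j, a j * Y.1 j‖ + ‖∑ j, d j * Y.2 j‖ := norm_add_le _ _
      _ ≤ √(∑ j, ‖a j‖ ^ 2) * √(∑ j, ‖Y.1 j‖ ^ 2) + √(∑ j, ‖d j‖ ^ 2) * √(∑ j, ‖Y.2 j‖ ^ 2) :=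
          add_le_add (norm_sum_mul_le _ _) (norm_sum_mul_le _ _)
      _ ≤ √(∑ j, μ j ^ 2) * ‖Y‖ + √(∑ j, μ j ^ 2) * ‖Y‖ := by
          have h1 := EuclideanSpace.norm_eq Y.1 ▸ norm_fst_le Y
          have h2 := EuclideanSpace.norm_eq Y.2 ▸ norm_snd_le Y
          exact add_le_add (mul_le_mul (hsqrt ha) h1 (Real.sqrt_nonneg _) (Real.sqrt_nonneg _))
            (mul_le_mul (hsqrt hd) h2 (Real.sqrt_nonneg _) (Real.sqrt_nonneg _))
      _ = 2 * √(∑ j, μ j ^ 2) * ‖Y‖ := by ring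
      _ ≤ 2 * √(∑ j, μ j ^ 2) * (κ * (2 * m * (κ * (2 * √(∑ j, μ j ^ 2))))) := by gcongr
      _ = 8 * m * κ ^ 2 * √(∑ j, μ j ^ 2) ^ 2 := by ring
      _ = _ := by rw [Real.sq_sqrt hμ0]

end Perturbation

/-! ### Closed formulas for one soliton and the diagonal blocks -/

section OneSoliton

/-- The logistic form of the tail mass of the one-soliton. -/
lemma oneSolitonTail_eq {v μ : ℝ} (hμ : 0 < μ) (x₀ φ₀ x t : ℝ) : oneSolitonTail v μ x₀ φ₀ x t =
    2 * μ / (Real.exp (2 * (μ * (x - x₀ - v * t))) + 1) := by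
  have hnorm : ∀ s, ‖oneSoliton v μ x₀ φ₀ s t‖ ^ 2 =
      (μ / Real.cosh (μ * (s - x₀ - v * t))) ^ 2 := by
    intro s
    rw [oneSoliton, norm_mul, mul_comm Complex.I, Complex.norm_exp_ofReal_mul_I, mul_one,
      Complex.norm_real, Real.norm_eq_abs, sq_abs]
  have hlin : ∀ s, HasDerivAt (fun s => 2 * (μ * (s - x₀ - v * t))) (2 * μ) s := by
    intro s
    have := ((((hasDerivAt_id s).sub_const x₀).sub_const (v * t)).const_mul μ).const_mul 2
    simpa using this
  -- With `y = μ(s - x₀ - vt)`, the function `-2μ/(e^{2y} + 1)` is the antiderivative of `μ² sech²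
  -- y` that vanishes at `+∞`.
  have hderiv : ∀ s ∈ Set.Ici x, HasDerivAt
      (fun s => -(2 * μ / (Real.exp (2 * (μ * (s - x₀ - v * t))) + 1)))
      (‖oneSoliton v μ x₀ φ₀ s t‖ ^ 2) s := by
    intro s _
    have hpos := Real.exp_pos (2 * (μ * (s - x₀ - v * t)))
    have h := (((hlin s).exp.add_const 1).inv (by positivity)).const_mul (-(2 * μ))
    refine (h.congr_of_eventuallyEq (Eventually.of_forall fun u => ?_)).congr_deriv ?_
    · simp only [Pi.inv_apply]
      rw [div_eq_mul_inv]; ring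
    · rw [hnorm, Real.cosh_eq, Real.exp_neg]
      set e := Real.exp (μ * (s - x₀ - v * t)) with he
      have hee : Real.exp (2 * (μ * (s - x₀ - v * t))) = e ^ 2 := by
        rw [he, ← Real.exp_nat_mul]; norm_num
      have he0 : 0 < e := Real.exp_pos _
      rw [hee]
      field_simp
  have hlim : Tendsto (fun s => -(2 * μ / (Real.exp (2 * (μ * (s - x₀ - v * t))) + 1))) atTop
      (𝓝 0) := by
    have h1 : Tendsto (fun s => 2 * (μ * (s - x₀ - v * t))) atTop atTop := by
      refine (Tendsto.const_mul_atTop hμ ?_).const_mul_atTop two_pos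
      exact tendsto_atTop_add_const_right _ _ (tendsto_atTop_add_const_right _ _ tendsto_id)
    have h2 := tendsto_atTop_add_const_right atTop (1 : ℝ) (Real.tendsto_exp_atTop.comp h1)
    simpa using (h2.const_div_atTop (2 * μ)).neg
  rw [oneSolitonTail, MeasureTheory.integral_Ioi_of_hasDerivAt_of_nonneg' hderiv
    (fun s _ => sq_nonneg _) hlim]
  ring

lemma norm_oneSoliton_le {v μ : ℝ} (hμ : 0 < μ) (x₀ φ₀ x t : ℝ) :
    ‖oneSoliton v μ x₀ φ₀ x t‖ ≤ μ := by
  have hc := Real.cosh_pos (μ * (x - x₀ - v * t))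
  rw [oneSoliton, norm_mul, mul_comm Complex.I, Complex.norm_exp_ofReal_mul_I, mul_one,
    Complex.norm_real, Real.norm_of_nonneg (by positivity)]
  exact div_le_self hμ.le (Real.one_le_cosh _)

lemma oneSolitonTail_nonneg (v μ x₀ φ₀ x t : ℝ) : 0 ≤ oneSolitonTail v μ x₀ φ₀ x t :=
  MeasureTheory.integral_nonneg fun _ => sq_nonneg _

lemma oneSolitonTail_le {v μ : ℝ} (hμ : 0 < μ) (x₀ φ₀ x t : ℝ) :
    oneSolitonTail v μ x₀ φ₀ x t ≤ 2 * μ := by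
  rw [oneSolitonTail_eq hμ]
  refine div_le_self (by positivity) ?_
  linarith [Real.exp_pos (2 * (μ * (x - x₀ - v * t)))]

lemma residueCoeff_eq (v μ x₀ φ₀ x t : ℝ) :
    residueCoeff (eigenvalue v μ) (normingCoeff μ x₀ φ₀) x t =
      Complex.I * μ * Real.exp (-(μ * (x - x₀ - v * t))) *
        Complex.exp (-(Complex.I * ((x * v - t / 2 * (v ^ 2 - μ ^ 2) - φ₀ : ℝ) : ℂ))) := by
  rw [residueCoeff, normingCoeff, theta, eigenvalue, Complex.ofReal_exp, mul_assoc, mul_assoc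
    (Complex.I * μ), ← Complex.exp_add, ← Complex.exp_add]
  congr 2
  push_cast
  linear_combination ((x : ℂ) * μ - t * v * μ + Complex.I * t * μ ^ 2 / 2) * Complex.I_sq

lemma oneSoliton_eq (v μ x₀ φ₀ x t : ℝ) : oneSoliton v μ x₀ φ₀ x t =
    -((μ / Real.cosh (μ * (x - x₀ - v * t)) : ℝ) : ℂ) *
      Complex.exp (Complex.I * ((x * v - t / 2 * (v ^ 2 - μ ^ 2) - φ₀ : ℝ) : ℂ)) := by
  rw [oneSoliton]
  have : Complex.I * ((x * v - t / 2 * (v ^ 2 - μ ^ 2) - φ₀ - Real.pi : ℝ) : ℂ) =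
      Complex.I * ((x * v - t / 2 * (v ^ 2 - μ ^ 2) - φ₀ : ℝ) : ℂ) - Real.pi * Complex.I := by
    push_cast; ring
  rw [this, Complex.exp_sub, Complex.exp_pi_mul_I]
  ring

/-- With `y = μ(x - x₀ - vt)` and `n = e^{-2y}`, this and the next two lemmas are the relations `a(1
+ n) = γ'`, `d(1 + n) = μ n` and `γ γ' = μ² n` required by `diagonal_block_iff`. -/
lemma half_oneSoliton_mul (v μ x₀ φ₀ x t : ℝ) :
    Complex.I / 2 * oneSoliton v μ x₀ φ₀ x t *
      (1 + (Real.exp (-(2 * (μ * (x - x₀ - v * t)))) : ℂ)) =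
      conj (residueCoeff (eigenvalue v μ) (normingCoeff μ x₀ φ₀) x t) := by
  rw [residueCoeff_eq, oneSoliton_eq]
  simp only [map_mul, Complex.conj_I, Complex.conj_ofReal, ← Complex.exp_conj, map_neg, neg_mul,
    neg_neg]
  set y := μ * (x - x₀ - v * t)
  have h : (μ / Real.cosh y) / 2 * (1 + Real.exp (-(2 * y))) = μ * Real.exp (-y) := by
    have h2 : Real.exp (-(2 * y)) = Real.exp (-y) ^ 2 := by
      rw [← Real.exp_nat_mul]; congr 1; push_cast; ring
    have h3 := Real.exp_pos y
    rw [Real.cosh_eq, h2, Real.exp_neg]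
    field_simp
  have h' : ((μ / Real.cosh y : ℝ) : ℂ) / 2 * (1 + (Real.exp (-(2 * y)) : ℂ)) =
      μ * (Real.exp (-y) : ℂ) := by exact_mod_cast congrArg (fun r : ℝ => (r : ℂ)) h
  linear_combination (-Complex.I * Complex.exp (Complex.I *
    ((x * v - t / 2 * (v ^ 2 - μ ^ 2) - φ₀ : ℝ) : ℂ))) * h'

lemma half_oneSolitonTail_mul {v μ : ℝ} (hμ : 0 < μ) (x₀ φ₀ x t : ℝ) :
    oneSolitonTail v μ x₀ φ₀ x t / 2 * (1 + Real.exp (-(2 * (μ * (x - x₀ - v * t))))) =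
      μ * Real.exp (-(2 * (μ * (x - x₀ - v * t)))) := by
  rw [oneSolitonTail_eq hμ, Real.exp_neg]
  have h := Real.exp_pos (2 * (μ * (x - x₀ - v * t)))
  field_simp

lemma residueCoeff_mul_conj (v μ x₀ φ₀ x t : ℝ) :
    residueCoeff (eigenvalue v μ) (normingCoeff μ x₀ φ₀) x t *
      conj (residueCoeff (eigenvalue v μ) (normingCoeff μ x₀ φ₀) x t) =
      (μ : ℂ) ^ 2 * (Real.exp (-(2 * (μ * (x - x₀ - v * t)))) : ℂ) := by
  rw [Complex.mul_conj', residueCoeff_eq]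
  have : ∀ r : ℝ, ‖Complex.exp (-(Complex.I * r))‖ = 1 := fun r => by
    rw [← mul_neg, mul_comm, ← Complex.ofReal_neg, Complex.norm_exp_ofReal_mul_I]
  rw [norm_mul, this, mul_one, norm_mul, norm_mul, Complex.norm_I, one_mul, Complex.norm_real,
    Complex.norm_real, Real.norm_of_nonneg (Real.exp_pos _).le, ← Complex.ofReal_pow, mul_pow,
    Real.norm_eq_abs, sq_abs, ← Real.exp_nat_mul]
  push_cast
  ring_nf

/-- Solving the diagonal `2 × 2` blocks of the residue system. -/
lemma diagonal_block_iff {μ n a a' d γ γ' f g p q : ℂ} (hμ : μ ≠ 0) (hn : 1 + n ≠ 0)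
    (ha : a * (1 + n) = γ') (ha' : a' * (1 + n) = γ) (hd : d * (1 + n) = μ * n)
    (hγ : γ * γ' = μ ^ 2 * n) :
    (p = γ' * (1 + Complex.I / μ * q + f) ∧ q = γ * (Complex.I / μ * p + g)) ↔
      (p = a * (1 + f) + Complex.I * d * g ∧ q = Complex.I * d * (1 + f) + a' * g) := by
  have hI := Complex.I_sq
  have hIμ : Complex.I / μ * μ = Complex.I := div_mul_cancel₀ _ hμ
  set J := Complex.I / μ with hJ
  -- The block has determinant `1 - J² γ γ' = 1 + n`, which is why everything below is multiplied by
  -- `1 + n`.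
  have hJJ : J ^ 2 * (γ * γ') = -n := by
    rw [hγ, hJ]; field_simp; linear_combination n * hI
  have hd' : Complex.I * d * (1 + n) = J * (γ * γ') := by
    rw [hγ, hJ]; field_simp; linear_combination hd
  constructor
  · rintro ⟨hp, hq⟩
    constructor
    · refine mul_right_cancel₀ hn ?_
      linear_combination hp + γ' * J * hq + p * hJJ - (1 + f) * ha - g * hd'
    · refine mul_right_cancel₀ hn ?_
      linear_combination hq + γ * J * hp + q * hJJ - (1 + f) * hd' - g * ha'
  · rintro ⟨hp, hq⟩
    constructor
    · refine mul_right_cancel₀ hn ?_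
      rw [hp, hq]
      linear_combination (1 + f) * ha + g * hd' - γ' * J * (1 + f) * hd' - γ' * J * g * ha' -
        (1 + f) * γ' * hJJ
    · refine mul_right_cancel₀ hn ?_
      rw [hp, hq]
      linear_combination (1 + f) * hd' + g * ha' - γ * J * (1 + f) * ha - γ * J * g * hd' -
        g * γ * hJJ

end OneSoliton

/-! ### Off-diagonal Cauchy matrices and the error estimate -/

section Assembly

variable {N : ℕ}

lemma eigenvalue_im (v μ : ℝ) : (eigenvalue v μ).im = μ / 2 := by
  simp [eigenvalue, Complex.add_im]

lemma eigenvalue_re (v μ : ℝ) : (eigenvalue v μ).re = -v / 2 := by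
  simp [eigenvalue, Complex.add_re]

lemma eigenvalue_injective {v : Fin N → ℝ} (hv : Function.Injective v) (μ : Fin N → ℝ) :
    Function.Injective fun k => eigenvalue (v k) (μ k) := by
  intro j k h
  have := congrArg Complex.re h
  simp only [eigenvalue_re] at this
  exact hv (by linarith)

/-- The off-diagonal part of the matrix `1 / (z_j - conj z_k)`. -/
def offDiagCauchy (z : Fin N → ℂ) : Matrix (Fin N) (Fin N) ℂ :=
  Matrix.of fun j k => if j = k then 0 else 1 / (z j - conj (z k))

/-- The off-diagonal part of the matrix `1 / (conj z_j - z_k)`. -/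
def offDiagCauchyConj (z : Fin N → ℂ) : Matrix (Fin N) (Fin N) ℂ :=
  Matrix.of fun j k => if j = k then 0 else 1 / (conj (z j) - z k)

lemma abs_half_le_norm (u : ℝ) (s : ℝ) : |u| / 2 ≤ ‖(-(u : ℂ) + Complex.I * s) / 2‖ := by
  have h := Complex.abs_re_le_norm ((-(u : ℂ) + Complex.I * s) / 2)
  have : ((-(u : ℂ) + Complex.I * s) / 2).re = -u / 2 := by
    simp [Complex.add_re]
  rwa [this, abs_div, abs_neg, abs_two] at h

/-- With `w = (-u + is)/2` one has `1/w + 2/u = is/(uw)`, and `‖w‖ ≥ |u|/2`. -/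
lemma norm_inv_add_two_inv_le {u s m : ℝ} (hu : u ≠ 0) (hs : |s| ≤ 2 * m) :
    ‖1 / ((-(u : ℂ) + Complex.I * s) / 2) + 2 * ((u⁻¹ : ℝ) : ℂ)‖ ≤ 4 * m * (u⁻¹) ^ 2 := by
  set w := (-(u : ℂ) + Complex.I * s) / 2 with hw
  have hm : 0 ≤ m := by linarith [(abs_nonneg _).trans hs]
  have hu' : 0 < |u| := abs_pos.2 hu
  have hwn : |u| / 2 ≤ ‖w‖ := abs_half_le_norm u s
  have hw0 : w ≠ 0 := norm_pos_iff.1 (by linarith)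
  have huc : (u : ℂ) ≠ 0 := Complex.ofReal_ne_zero.2 hu
  have h : 1 / w + 2 * ((u⁻¹ : ℝ) : ℂ) = Complex.I * s / (u * w) := by
    push_cast
    field_simp
    rw [hw]; ring
  rw [h, norm_div, norm_mul, norm_mul, Complex.norm_I, one_mul, Complex.norm_real,
    Complex.norm_real, Real.norm_eq_abs, Real.norm_eq_abs]
  calc |s| / (|u| * ‖w‖) ≤ 2 * m / (|u| * (|u| / 2)) := by gcongr
    _ = _ := by rw [inv_pow, ← sq_abs u]; field_simp; ring

lemma norm_inv_sub_inv_le {u s s' m : ℝ} (hu : u ≠ 0) (hs : |s - s'| ≤ 2 * m) :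
    ‖1 / ((-(u : ℂ) + Complex.I * s) / 2) - 1 / ((-(u : ℂ) + Complex.I * s') / 2)‖ ≤
      4 * m * (u⁻¹) ^ 2 := by
  set w := (-(u : ℂ) + Complex.I * s) / 2 with hw
  set w' := (-(u : ℂ) + Complex.I * s') / 2 with hw'
  have hm : 0 ≤ m := by linarith [(abs_nonneg _).trans hs]
  have hu' : 0 < |u| := abs_pos.2 hu
  have hwn : |u| / 2 ≤ ‖w‖ := abs_half_le_norm u s
  have hwn' : |u| / 2 ≤ ‖w'‖ := abs_half_le_norm u s'
  have hw0 : w ≠ 0 := norm_pos_iff.1 (by linarith)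
  have hw0' : w' ≠ 0 := norm_pos_iff.1 (by linarith)
  have h : 1 / w - 1 / w' = -(Complex.I / 2 * ((s - s' : ℝ) : ℂ)) / (w * w') := by
    field_simp
    rw [hw, hw']
    push_cast
    ring
  rw [h, norm_div, norm_neg, norm_mul, norm_div, norm_mul, Complex.norm_I, Complex.norm_real,
    Real.norm_eq_abs, Complex.norm_ofNat]
  calc 1 / 2 * |s - s'| / (‖w‖ * ‖w'‖) ≤ 1 / 2 * (2 * m) / ((|u| / 2) * (|u| / 2)) := by gcongr
    _ = _ := by rw [inv_pow, ← sq_abs u]; field_simp; ring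

lemma eigenvalue_sub_conj (v μ v' μ' : ℝ) : eigenvalue v μ - conj (eigenvalue v' μ') =
    (-((v - v' : ℝ) : ℂ) + Complex.I * ((μ + μ' : ℝ) : ℂ)) / 2 := by
  simp only [eigenvalue, map_div₀, map_add, map_neg, map_mul, Complex.conj_I, Complex.conj_ofReal,
    map_ofNat]
  push_cast; ring

lemma conj_eigenvalue_sub (v μ v' μ' : ℝ) : conj (eigenvalue v μ) - eigenvalue v' μ' =
    (-((v - v' : ℝ) : ℂ) + Complex.I * ((-(μ + μ') : ℝ) : ℂ)) / 2 := by
  simp only [eigenvalue, map_div₀, map_add, map_neg, map_mul, Complex.conj_I, Complex.conj_ofReal,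
    map_ofNat]
  push_cast; ring

lemma conj_eigenvalue_sub_conj (v μ v' μ' : ℝ) : conj (eigenvalue v μ) - conj (eigenvalue v' μ') =
    (-((v - v' : ℝ) : ℂ) + Complex.I * ((-μ + μ' : ℝ) : ℂ)) / 2 := by
  simp only [eigenvalue, map_div₀, map_add, map_neg, map_mul, Complex.conj_I, Complex.conj_ofReal,
    map_ofNat]
  push_cast; ring

/-- The residue system of the reflectionless data is a coupled linear system whose coefficients
are one-solitons and their tails. -/
lemma residueSystem_iff {v μ : Fin N → ℝ} (hμ : ∀ k, 0 < μ k) (x₀ φ : Fin N → ℝ) (x t : ℝ)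
    (p q : Fin N → ℂ) :
    IsResidueSystemSolution (fun k => eigenvalue (v k) (μ k))
      (fun k => residueCoeff (eigenvalue (v k) (μ k)) (normingCoeff (μ k) (x₀ k) (φ k)) x t) p q ↔
    IsCoupledSolution
      (fun k => Complex.I / 2 * oneSoliton (v k) (μ k) (x₀ k) (φ k) x t)
      (fun k => conj (Complex.I / 2 * oneSoliton (v k) (μ k) (x₀ k) (φ k) x t))
      (fun k => Complex.I * ((oneSolitonTail (v k) (μ k) (x₀ k) (φ k) x t / 2 : ℝ) : ℂ))
      (offDiagCauchy fun k => eigenvalue (v k) (μ k))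
      (offDiagCauchyConj fun k => eigenvalue (v k) (μ k)) p q := by
  refine forall_congr' fun j => ?_
  have hμj : (μ j : ℂ) ≠ 0 := Complex.ofReal_ne_zero.2 (hμ j).ne'
  have hI : (1 : ℂ) / (Complex.I * μ j) = -(Complex.I / μ j) := by
    field_simp; linear_combination Complex.I_sq
  set n := Real.exp (-(2 * (μ j * (x - x₀ j - v j * t)))) with hn
  have hn0 : (1 : ℂ) + (n : ℂ) ≠ 0 := by
    have : (0 : ℝ) < 1 + n := by positivity
    exact_mod_cast this.ne'
  set z : Fin N → ℂ := fun k => eigenvalue (v k) (μ k) with hz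
  -- The term `k = j`, where `conj z_j - z_j = -iμ_j`, is the self-interaction that joins the
  -- diagonal block.
  have e1 : partialFraction 1 q z (conj (z j)) =
      1 + Complex.I / μ j * q j + ∑ k, offDiagCauchyConj z j k * q k := by
    rw [partialFraction, add_assoc, ← Finset.sum_erase_add _ _ (Finset.mem_univ j),
      ← Finset.sum_erase_add (a := j) _ (fun k => offDiagCauchyConj z j k * q k)
        (Finset.mem_univ j)]
    have h1 : q j / (conj (z j) - z j) = Complex.I / μ j * q j := by
      have : conj (z j) - z j = -(Complex.I * μ j) := by
        rw [hz, conj_eigenvalue_sub]; push_cast; ring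
      rw [this, div_neg, div_eq_mul_one_div, hI]; ring
    have h2 : ∑ k ∈ Finset.univ.erase j, q k / (conj (z j) - z k) =
        ∑ k ∈ Finset.univ.erase j, offDiagCauchyConj z j k * q k :=
      Finset.sum_congr rfl fun k hk => by
        rw [offDiagCauchyConj, Matrix.of_apply, if_neg (Finset.ne_of_mem_erase hk).symm]; ring
    have h3 : offDiagCauchyConj z j j = 0 := by simp [offDiagCauchyConj]
    rw [h1, h2, h3]; ring
  have e2 : partialFraction 0 (-p) (fun l => conj (z l)) (z j) =
      Complex.I / μ j * p j + -∑ k, offDiagCauchy z j k * p k := by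
    rw [partialFraction, zero_add, ← Finset.sum_erase_add _ _ (Finset.mem_univ j),
      ← Finset.sum_erase_add (a := j) _ (fun k => offDiagCauchy z j k * p k)
        (Finset.mem_univ j)]
    have h1 : (-p) j / (z j - conj (z j)) = Complex.I / μ j * p j := by
      have : z j - conj (z j) = Complex.I * μ j := by
        rw [hz, eigenvalue_sub_conj]; push_cast; ring
      rw [this, div_eq_mul_one_div, hI, Pi.neg_apply]; ring
    have h2 : ∑ k ∈ Finset.univ.erase j, (-p) k / (z j - conj (z k)) =
        -∑ k ∈ Finset.univ.erase j, offDiagCauchy z j k * p k := by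
      rw [← Finset.sum_neg_distrib]
      refine Finset.sum_congr rfl fun k hk => ?_
      rw [offDiagCauchy, Matrix.of_apply, if_neg (Finset.ne_of_mem_erase hk).symm, Pi.neg_apply]
      ring
    have h3 : offDiagCauchy z j j = 0 := by simp [offDiagCauchy]
    rw [h1, h2, h3]; ring
  rw [e1, e2]
  refine diagonal_block_iff hμj hn0 (half_oneSoliton_mul _ _ _ _ _ _) ?_ ?_
    (residueCoeff_mul_conj _ _ _ _ _ _)
  · have := congrArg conj (half_oneSoliton_mul (v j) (μ j) (x₀ j) (φ j) x t)
    rw [Complex.conj_conj, map_mul, map_add, map_one, Complex.conj_ofReal] at this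
    exact this
  · have := congrArg (fun r : ℝ => (r : ℂ))
      (half_oneSolitonTail_mul (v := v j) (hμ j) (x₀ j) (φ j) x t)
    simp only [← hn] at this
    exact_mod_cast this

/-- The constant in the operator norm bound for the off-diagonal Cauchy matrices. -/
def cauchyConst : ℝ := 2 * √(3 * sepConst) + 4 * sepConst

lemma cauchyConst_nonneg : 0 ≤ cauchyConst := by
  have := sepConst_nonneg
  unfold cauchyConst
  positivity

lemma norm_offDiagCauchy_le {v μ : Fin N → ℝ} {δ : ℝ} (hδ : 0 < δ)
    (hv : ∀ j k, j ≠ k → δ ≤ |v j - v k|) (hμδ : ‖μ‖ ≤ δ) :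
    ‖Matrix.toEuclideanCLM (𝕜 := ℂ) (offDiagCauchy fun k => eigenvalue (v k) (μ k))‖ ≤
      cauchyConst / δ ∧
    ‖Matrix.toEuclideanCLM (𝕜 := ℂ) (offDiagCauchyConj fun k => eigenvalue (v k) (μ k))‖ ≤
      cauchyConst / δ := by
  have hs : ∀ j k, |μ j + μ k| ≤ 2 * ‖μ‖ := fun j k => by
    have h1 := norm_le_pi_norm μ j
    have h2 := norm_le_pi_norm μ k
    rw [Real.norm_eq_abs] at h1 h2
    linarith [abs_add_le (μ j) (μ k)]
  have hu : ∀ j k, j ≠ k → v j - v k ≠ 0 := fun j k h => abs_pos.1 (hδ.trans_le (hv j k h))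
  constructor
  · refine norm_toEuclideanCLM_le hδ hμδ hv fun j k => ?_
    rw [offDiagCauchy, Matrix.of_apply]
    split_ifs with h
    · subst h; simp
    · rw [eigenvalue_sub_conj]
      exact norm_inv_add_two_inv_le (hu j k h) (hs j k)
  · refine norm_toEuclideanCLM_le hδ hμδ hv fun j k => ?_
    rw [offDiagCauchyConj, Matrix.of_apply]
    split_ifs with h
    · subst h; simp
    · rw [conj_eigenvalue_sub]
      exact norm_inv_add_two_inv_le (hu j k h) (by rw [abs_neg]; exact hs j k)

lemma IsNSolitonSolution.exists_residueSystem {z c : Fin N → ℂ} {ψ : ℝ → ℝ → ℂ}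
    (h : IsNSolitonSolution z c ψ) (hz : Function.Injective z) (him : ∀ k, 0 < (z k).im)
    (x t : ℝ) : ∃ p q, IsResidueSystemSolution z (fun k => residueCoeff (z k) (c k) x t) p q ∧
      ψ x t = -2 * Complex.I * ∑ k, p k := by
  obtain ⟨M, hM, hlim⟩ := h x t
  obtain ⟨p, q, hpq, hlim'⟩ := hM.exists_residueSystem hz him
  exact ⟨p, q, hpq, tendsto_nhds_unique hlim hlim'⟩

/-- Everything is pointwise in `(x, t)`: the limit defining `ψ` depends on `M` only through `p`,
which the system determines. -/
lemma existsUnique_nSoliton {z c : Fin N → ℂ} (hz : Function.Injective z)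
    (him : ∀ k, 0 < (z k).im)
    (h : ∀ x t, ∃! pq : (Fin N → ℂ) × (Fin N → ℂ),
      IsResidueSystemSolution z (fun k => residueCoeff (z k) (c k) x t) pq.1 pq.2) :
    ∃! ψ : ℝ → ℝ → ℂ, IsNSolitonSolution z c ψ := by
  choose pq hpq huniq using h
  refine ⟨fun x t => -2 * Complex.I * ∑ k, (pq x t).1 k, fun x t =>
    ⟨rhpMatrix z (pq x t).1 (pq x t).2, (hpq x t).isRHPSolution hz him, tendsto_rhpMatrix _ _ _⟩,
    fun ψ hψ => ?_⟩
  funext x t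
  obtain ⟨p, q, hs, hval⟩ := hψ.exists_residueSystem hz him x t
  rw [hval, ← huniq x t (p, q) hs]

lemma coupledSolution_of_separated {v μ : Fin N → ℝ} {δ : ℝ} (hμ : ∀ k, 0 < μ k) (hδ : 0 < δ)
    (hv : ∀ j k, j ≠ k → δ ≤ |v j - v k|) (hμδ : (4 * cauchyConst + 1) * ‖μ‖ ≤ δ)
    (x₀ φ : Fin N → ℝ) (x t : ℝ) :
    let a : Fin N → ℂ := fun k => Complex.I / 2 * oneSoliton (v k) (μ k) (x₀ k) (φ k) x t
    let d : Fin N → ℂ := fun k =>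
      Complex.I * ((oneSolitonTail (v k) (μ k) (x₀ k) (φ k) x t / 2 : ℝ) : ℂ)
    let b := offDiagCauchy fun k => eigenvalue (v k) (μ k)
    let b' := offDiagCauchyConj fun k => eigenvalue (v k) (μ k)
    (∃! pq : (Fin N → ℂ) × (Fin N → ℂ),
      IsCoupledSolution a (fun k => conj (a k)) d b b' pq.1 pq.2) ∧
    ∀ p q, IsCoupledSolution a (fun k => conj (a k)) d b b' p q →
      ‖∑ j, p j - (∑ j, a j +
        ∑ j, (a j * ∑ k, b' j k * d k - d j * ∑ k, b j k * a k))‖ ≤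
        8 * ‖μ‖ * (cauchyConst / δ) ^ 2 * ∑ j, μ j ^ 2 := by
  intro a d b b'
  have hK := cauchyConst_nonneg
  have hμn := norm_nonneg μ
  -- In the factor `4 * cauchyConst + 1`, the `1` secures `‖μ‖ ≤ δ` here, and `4 * cauchyConst`
  -- secures `mκ ≤ 1/4` below.
  obtain ⟨hb, hb'⟩ := norm_offDiagCauchy_le (μ := μ) hδ hv (by nlinarith)
  have ha : ∀ j, ‖a j‖ ≤ μ j := fun j => by
    have := norm_oneSoliton_le (v := v j) (hμ j) (x₀ j) (φ j) x t
    simp only [a, norm_mul, norm_div, Complex.norm_I, Complex.norm_ofNat]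
    linarith [hμ j]
  refine coupledSolution (m := ‖μ‖) (fun j => (le_abs_self _).trans (norm_le_pi_norm μ j)) hμn ha
    (fun j => by rw [RCLike.norm_conj]; exact ha j) (fun j => ?_) hb hb' ?_
  · have h1 := oneSolitonTail_nonneg (v j) (μ j) (x₀ j) (φ j) x t
    have h2 := oneSolitonTail_le (v := v j) (hμ j) (x₀ j) (φ j) x t
    simp only [d, norm_mul, Complex.norm_I, one_mul, Complex.norm_real]
    rw [Real.norm_of_nonneg (by positivity)]
    linarith
  · rw [mul_div_assoc', div_le_iff₀ hδ]
    linarith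

/-- Replacing `1 / (conj z_j - conj z_k)` by `1 / (conj z_j - z_k)` in the interaction term costs
no more than the error of the second-order expansion. -/
lemma norm_interaction_sub_le {v μ : Fin N → ℝ} {δ : ℝ} (hμ : ∀ k, 0 < μ k) (hδ : 0 < δ)
    (hv : ∀ j k, j ≠ k → δ ≤ |v j - v k|) (x₀ φ : Fin N → ℝ) (x t : ℝ) :
    let a : Fin N → ℂ := fun k => Complex.I / 2 * oneSoliton (v k) (μ k) (x₀ k) (φ k) x t
    let d : Fin N → ℂ := fun k =>
      Complex.I * ((oneSolitonTail (v k) (μ k) (x₀ k) (φ k) x t / 2 : ℝ) : ℂ)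
    let b := offDiagCauchy fun k => eigenvalue (v k) (μ k)
    let b' := offDiagCauchyConj fun k => eigenvalue (v k) (μ k)
    ‖-2 * Complex.I * (∑ j, a j + ∑ j, (a j * ∑ k, b' j k * d k - d j * ∑ k, b j k * a k)) -
      ((∑ k, oneSoliton (v k) (μ k) (x₀ k) (φ k) x t) + pairInteraction v μ x₀ φ x t)‖ ≤
      4 * ‖μ‖ * (sepConst / δ ^ 2) * ∑ j, μ j ^ 2 := by
  intro a d b b'
  set z : Fin N → ℂ := fun k => eigenvalue (v k) (μ k) with hz
  set ψ : Fin N → ℂ := fun k => oneSoliton (v k) (μ k) (x₀ k) (φ k) x t with hψ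
  set m : Fin N → ℝ := fun k => oneSolitonTail (v k) (μ k) (x₀ k) (φ k) x t with hm
  have hu : ∀ j k, j ≠ k → v j - v k ≠ 0 := fun j k h => abs_pos.1 (hδ.trans_le (hv j k h))
  have hI := Complex.I_sq
  have hinv : (1 : ℂ) / (2 * Complex.I) = -(Complex.I / 2) := by
    rw [div_eq_iff (by simp)]
    linear_combination hI
  -- The `b` half of the second-order term agrees exactly with the stated interaction; only the `b'`
  -- half has a different denominator, and `r` is that discrepancy.
  set r : Fin N → Fin N → ℂ := fun j k => if j = k then 0 else
    Complex.I / 2 * (ψ j * m k) * (1 / (conj (z j) - z k) - 1 / (conj (z j) - conj (z k))) with hr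
  have key : -2 * Complex.I * (∑ j, a j + ∑ j, (a j * ∑ k, b' j k * d k -
      d j * ∑ k, b j k * a k)) - ((∑ k, ψ k) + pairInteraction v μ x₀ φ x t) =
      ∑ j, ∑ k, r j k := by
    have h1 : -2 * Complex.I * ∑ j, a j = ∑ k, ψ k := by
      rw [Finset.mul_sum]
      refine Finset.sum_congr rfl fun j _ => ?_
      simp only [a]
      linear_combination (-ψ j) * hI
    have h2 : -2 * Complex.I * ∑ j, (a j * ∑ k, b' j k * d k - d j * ∑ k, b j k * a k) -
        pairInteraction v μ x₀ φ x t = ∑ j, ∑ k, r j k := by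
      rw [pairInteraction, hinv, Finset.mul_sum, Finset.mul_sum, ← Finset.sum_sub_distrib]
      refine Finset.sum_congr rfl fun j _ => ?_
      rw [Finset.sum_filter, Finset.mul_sum, Finset.mul_sum, ← Finset.sum_sub_distrib,
        Finset.mul_sum, Finset.mul_sum, ← Finset.sum_sub_distrib]
      refine Finset.sum_congr rfl fun k _ => ?_
      by_cases hjk : j = k
      · subst hjk
        simp [hr, b, b', offDiagCauchy, offDiagCauchyConj]
      · simp only [hr, b, b', offDiagCauchy, offDiagCauchyConj, Matrix.of_apply, hjk, if_false,
          ne_eq, Ne.symm hjk, not_false_eq_true, if_true, a, d]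
        change _ - -(Complex.I / 2) * (ψ k * m j / (z j - conj (z k)) -
          m k * ψ j / (conj (z j) - conj (z k))) = _
        simp only [div_eq_mul_inv, one_mul, Complex.ofReal_mul, Complex.ofReal_inv,
          Complex.ofReal_ofNat]
        generalize (conj (z j) - z k)⁻¹ = A
        generalize (z j - conj (z k))⁻¹ = B
        generalize (conj (z j) - conj (z k))⁻¹ = G
        linear_combination (-Complex.I / 2) * (ψ j * m k * A - ψ k * m j * B) * hI
    linear_combination h1 + h2
  have hrle : ∀ j k, ‖r j k‖ ≤ 4 * ‖μ‖ * (μ k ^ 2 * ((v k - v j)⁻¹) ^ 2) := by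
    intro j k
    simp only [hr]
    split_ifs with hjk
    · rw [norm_zero]; positivity
    · have h1 : ‖ψ j‖ ≤ ‖μ‖ := (norm_oneSoliton_le (hμ j) _ _ _ _).trans
        ((le_abs_self _).trans (norm_le_pi_norm μ j))
      have h2 : ‖(m k : ℂ)‖ ≤ 2 * μ k := by
        rw [Complex.norm_real, Real.norm_of_nonneg (oneSolitonTail_nonneg _ _ _ _ _ _)]
        exact oneSolitonTail_le (hμ k) _ _ _ _
      have h3 : ‖1 / (conj (z j) - z k) - 1 / (conj (z j) - conj (z k))‖ ≤
          4 * μ k * ((v j - v k)⁻¹) ^ 2 := by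
        simp only [hz]
        rw [conj_eigenvalue_sub, conj_eigenvalue_sub_conj]
        refine norm_inv_sub_inv_le (hu j k hjk) (le_of_eq ?_)
        rw [show -(μ j + μ k) - (-μ j + μ k) = -(2 * μ k) by ring, abs_neg, abs_of_pos]
        linarith [hμ k]
      have h4 : ((v j - v k)⁻¹) ^ 2 = ((v k - v j)⁻¹) ^ 2 := by rw [← neg_sub, inv_neg, neg_sq]
      rw [norm_mul, norm_mul, norm_div, Complex.norm_I, Complex.norm_ofNat, norm_mul]
      calc _ ≤ 1 / 2 * (‖μ‖ * (2 * μ k)) * (4 * μ k * ((v j - v k)⁻¹) ^ 2) := by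
            have := (hμ k).le
            gcongr
        _ = _ := by rw [h4]; ring
  rw [key]
  calc _ ≤ ∑ j, ∑ k, 4 * ‖μ‖ * (μ k ^ 2 * ((v k - v j)⁻¹) ^ 2) :=
        (norm_sum_le _ _).trans (Finset.sum_le_sum fun j _ => (norm_sum_le _ _).trans
          (Finset.sum_le_sum fun k _ => hrle j k))
    -- Both `m⁽ᵏ⁾` and the difference of reciprocals contribute a factor `μ_k`, so summing over `j`
    -- first leaves `∑ μ_k²`.
    _ = ∑ k, 4 * ‖μ‖ * (μ k ^ 2 * ∑ j, ((v k - v j)⁻¹) ^ 2) := by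
        rw [Finset.sum_comm]
        simp_rw [Finset.mul_sum]
    _ ≤ ∑ k, 4 * ‖μ‖ * (μ k ^ 2 * (sepConst / δ ^ 2)) := by
        gcongr with k
        exact sum_inv_sq_le hδ hv k
    _ = _ := by
        rw [← Finset.mul_sum, ← Finset.sum_mul]; ring

/-- The constant in the error estimate. -/
def errorConst : ℝ := 16 * cauchyConst ^ 2 + 4 * sepConst + 1

lemma errorConst_pos : 0 < errorConst := by
  have := sepConst_nonneg
  unfold errorConst
  positivity

/-- The estimate for `δ`-separated velocities. -/
lemma norm_nSoliton_sub_le {v μ : Fin N → ℝ} {δ : ℝ} (hμ : ∀ k, 0 < μ k)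
    (hinj : Function.Injective v) (hδ : 0 < δ)
    (hv : ∀ j k, j ≠ k → δ ≤ |v j - v k|) (hμδ : (4 * cauchyConst + 1) * ‖μ‖ ≤ δ)
    {x₀ φ : Fin N → ℝ} {ψ : ℝ → ℝ → ℂ}
    (hψ : IsNSolitonSolution (fun k => eigenvalue (v k) (μ k))
      (fun k => normingCoeff (μ k) (x₀ k) (φ k)) ψ) (x t : ℝ) :
    ‖ψ x t - ((∑ k, oneSoliton (v k) (μ k) (x₀ k) (φ k) x t) +
      pairInteraction v μ x₀ φ x t)‖ ≤ errorConst * (‖μ‖ * ∑ k, |μ k| ^ 2) / δ ^ 2 := by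
  obtain ⟨p, q, hs, hval⟩ := hψ.exists_residueSystem (eigenvalue_injective hinj μ)
    (fun k => by rw [eigenvalue_im]; exact half_pos (hμ k)) x t
  have h1 := (coupledSolution_of_separated hμ hδ hv hμδ x₀ φ x t).2 p q
    ((residueSystem_iff hμ x₀ φ x t p q).1 hs)
  have h2 := norm_interaction_sub_le hμ hδ hv x₀ φ x t
  simp only at h1 h2
  rw [hval]
  have hsq : (0 : ℝ) ≤ ∑ k, μ k ^ 2 := Finset.sum_nonneg fun _ _ => sq_nonneg _
  simp_rw [sq_abs]
  set S := ∑ j, Complex.I / 2 * oneSoliton (v j) (μ j) (x₀ j) (φ j) x t + _ with hS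
  set R := (∑ k, oneSoliton (v k) (μ k) (x₀ k) (φ k) x t) + pairInteraction v μ x₀ φ x t
  have e : -2 * Complex.I * ∑ k, p k - R =
      -2 * Complex.I * (∑ k, p k - S) + (-2 * Complex.I * S - R) := by ring
  calc _ ≤ ‖-2 * Complex.I * (∑ k, p k - S)‖ + ‖-2 * Complex.I * S - R‖ := by
        rw [e]; exact norm_add_le _ _
    _ ≤ 2 * (8 * ‖μ‖ * (cauchyConst / δ) ^ 2 * ∑ j, μ j ^ 2) +
        4 * ‖μ‖ * (sepConst / δ ^ 2) * ∑ j, μ j ^ 2 := by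
        refine add_le_add ?_ h2
        rw [norm_mul, norm_mul, norm_neg, Complex.norm_I, Complex.norm_ofNat, mul_one]
        exact mul_le_mul_of_nonneg_left h1 two_pos.le
    _ = (16 * cauchyConst ^ 2 + 4 * sepConst) * (‖μ‖ * ∑ k, μ k ^ 2) / δ ^ 2 := by
        field_simp; ring
    -- The extra `1` in `errorConst` only guarantees positivity.
    _ ≤ _ := by
        unfold errorConst
        have := mul_nonneg (norm_nonneg μ) hsq
        exact div_le_div_of_nonneg_right (mul_le_mul_of_nonneg_right (by linarith) this)
          (by positivity)

lemma velocityGap_le (v : Fin N → ℝ) {j k : Fin N} (h : j ≠ k) :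
    velocityGap v ≤ ENNReal.ofReal |v j - v k| :=
  (iInf_le _ j).trans ((iInf_le _ k).trans (iInf_le _ h))

end Assembly

end FNLS

end

theorem theorem1p2 :
    ∃ Cs : ℝ, 0 < Cs ∧ ∃ C : ℝ, 0 < C ∧
      ∀ (N : ℕ) (v μ x₀ φ : Fin N → ℝ), (∀ k, 0 < μ k) → Function.Injective v →
        ENNReal.ofReal (Cs * ‖μ‖) < FNLS.velocityGap v →
        (∃! ψN : ℝ → ℝ → ℂ, FNLS.IsNSolitonSolution
          (fun k => FNLS.eigenvalue (v k) (μ k))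
          (fun k => FNLS.normingCoeff (μ k) (x₀ k) (φ k)) ψN) ∧
        ∀ ψN : ℝ → ℝ → ℂ, FNLS.IsNSolitonSolution
          (fun k => FNLS.eigenvalue (v k) (μ k))
          (fun k => FNLS.normingCoeff (μ k) (x₀ k) (φ k)) ψN →
        ∀ x t : ℝ,
          ‖ψN x t - ((∑ k, FNLS.oneSoliton (v k) (μ k) (x₀ k) (φ k) x t) +
              FNLS.pairInteraction v μ x₀ φ x t)‖ₑ ≤
            ENNReal.ofReal (C * (‖μ‖ * ∑ k, |μ k| ^ 2)) / FNLS.velocityGap v ^ 2 := by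
  have hK := FNLS.cauchyConst_nonneg
  refine ⟨4 * FNLS.cauchyConst + 1, by positivity, FNLS.errorConst, FNLS.errorConst_pos, ?_⟩
  intro N v μ x₀ φ hμ hinj hgap
  obtain ⟨δ, hδ, hμδ, hδgap⟩ : ∃ δ : ℝ, 0 < δ ∧ (4 * FNLS.cauchyConst + 1) * ‖μ‖ ≤ δ ∧
      ENNReal.ofReal δ ≤ FNLS.velocityGap v := by
    -- With an infinite gap any real `δ` is admissible; otherwise the gap itself serves.
    by_cases htop : FNLS.velocityGap v = ⊤
    · exact ⟨(4 * FNLS.cauchyConst + 1) * ‖μ‖ + 1, by positivity, by linarith,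
        htop ▸ le_top⟩
    · refine ⟨(FNLS.velocityGap v).toReal, ENNReal.toReal_pos (pos_of_gt hgap).ne' htop, ?_,
        ENNReal.ofReal_toReal_le⟩
      exact ((ENNReal.ofReal_lt_iff_lt_toReal (by positivity) htop).1 hgap).le
  have hsep : ∀ δ : ℝ, ENNReal.ofReal δ ≤ FNLS.velocityGap v →
      ∀ j k, j ≠ k → δ ≤ |v j - v k| := fun δ h j k hjk =>
    (ENNReal.ofReal_le_ofReal_iff (abs_nonneg _)).1 (h.trans (FNLS.velocityGap_le v hjk))
  refine ⟨FNLS.existsUnique_nSoliton (FNLS.eigenvalue_injective hinj μ)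
    (fun k => by rw [FNLS.eigenvalue_im]; exact half_pos (hμ k)) fun x t => ?_,
    fun ψ hψ x t => ?_⟩
  · simp_rw [FNLS.residueSystem_iff hμ]
    exact (FNLS.coupledSolution_of_separated hμ hδ (hsep δ hδgap) hμδ x₀ φ x t).1
  have hbound := fun (η : ℝ) (h0 : 0 < η) (h1 : ENNReal.ofReal η ≤ FNLS.velocityGap v)
    (h2 : (4 * FNLS.cauchyConst + 1) * ‖μ‖ ≤ η) =>
    FNLS.norm_nSoliton_sub_le hμ hinj h0 (hsep η h1) h2 hψ x t
  by_cases htop : FNLS.velocityGap v = ⊤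
  -- An infinite gap makes the right-hand side `0`. The bound holds for every `η ≥ δ`, so letting `η
  -- → ∞` gives an exact equality.
  · have hlim : Filter.Tendsto (fun η : ℝ =>
        FNLS.errorConst * (‖μ‖ * ∑ k, |μ k| ^ 2) / η ^ 2) Filter.atTop (𝓝 0) :=
      (Filter.tendsto_pow_atTop two_ne_zero).const_div_atTop _
    have h0 := ge_of_tendsto hlim ((Filter.eventually_ge_atTop δ).mono fun η hη =>
      hbound η (hδ.trans_le hη) (htop ▸ le_top) (hμδ.trans hη))
    rw [norm_le_zero_iff.1 h0, enorm_zero]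
    exact zero_le
  · set η := (FNLS.velocityGap v).toReal with hη
    have hofη : ENNReal.ofReal η = FNLS.velocityGap v := ENNReal.ofReal_toReal htop
    have hη0 : 0 < η := ENNReal.toReal_pos (pos_of_gt hgap).ne' htop
    have h := hbound η hη0 hofη.le
      ((ENNReal.ofReal_lt_iff_lt_toReal (by positivity) htop).1 hgap).le
    rw [← hofη, ← ENNReal.ofReal_pow hη0.le, ← ENNReal.ofReal_div_of_pos (by positivity),
      ← ofReal_norm]
    exact ENNReal.ofReal_le_ofReal h
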